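/- Work over $\mathbb{Q}$. Let $X$ be a simply connected space of the homotopy type of a CW complex of finite type (finitely many cells in each dimension), and let $(\Lambda V,d)$ be a Sullivan model of $X$: a Sullivan algebra ($V=V^{\ge 1}$ is the union of graded subspaces $V(0)\subset V(1)\subset\cdots$ with $d=0$ on $V(0)$ and $dV(k+1)\subset\Lambda V(k)$) together with a quasi-isomorphism of commutative cochain algebras $(\Lambda V,d)\to A_{PL}(X)$, where $A_{PL}(X)$ is Sullivan's cochain algebra of polynomial differential forms on the singular simplices of $X$. Let $\mu\colon(\Lambda V\otimes\Lambda V,d)\to(\Lambda V,d)$ be the multiplication and, for $n\ge 0$, let $$p_n\colon(\Lambda V\otimes\Lambda V,d)\to\left(\frac{\Lambda V\otimes\Lambda V}{(\ker\mu)^{n+1}},\bar d\right)$$ be the projection. A morphism $f\colon M\to N$ of differential ($\mathbb{Z}$-graded) modules over a commutative cochain algebra admits a homotopy retraction if there are a differential module $P$, a quasi-isomorphism of modules $\psi\colon P\to N$ and morphisms of modules $j\colon M\to P$, $\rho\colon P\to M$ with $\psi j=f$ and $\rho j=\mathrm{id}_M$. Let $\mathbf{mtc}(X)$ be the least integer $n\ge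 0$ such that $p_n$ admits a homotopy retraction as a morphism of $(\Lambda V\otimes\Lambda V,d)$-modules, and $\mathbf{htc}(X)$ the least integer $n\ge 0$ such that $H(p_n)$ is injective (each is $\infty$ if there is no such $n$). A Poincaré duality algebra is a finite dimensional commutative graded algebra $H$ with $H^0=\mathbb{Q}$, concentrated in degrees $0\le p\le n$ for some $n$, for which there is $\Omega\in H^n$ with $H^n=\mathbb{Q}\cdot\Omega$ such that $a\mapsto(b\mapsto\Omega^\sharp(ab))$ is an isomorphism $H\to\operatorname{Hom}(H,\mathbb{Q})$, where $\Omega^\sharp(\Omega)=1$ and $\Omega^\sharp(H^{\ne n})=0$. If the rational cohomology algebra $H^*(X)=H(A_{PL}(X))$ is a Poincaré duality algebra, then $\mathbf{htc}(X)=\mathbf{mtc}(X)$. -/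

import Mathlib

universe u v w

noncomputable section

open scoped DirectSum TensorProduct

namespace RHT

/-! ### Gradings -/

/-- A family of subspaces that spans and admits a family of projections is a grading. -/
theorem isInternal_of_proj {M : Type u} [AddCommGroup M] [Module ℚ M] (G : ℤ → Submodule ℚ M)
    (π : ℤ → M →ₗ[ℚ] M) (h1 : ∀ p, ∀ x ∈ G p, π p x = x)
    (h2 : ∀ p q, q ≠ p → ∀ x ∈ G q, π p x = 0) (h3 : ⨆ p, G p = ⊤) :
    DirectSum.IsInternal G := by
  refine DirectSum.isInternal_submodule_of_iSupIndep_of_iSup_eq_top (fun p => ?_) h3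
  rw [Submodule.disjoint_def]
  intro x hx hx'
  have hk : (⨆ q, ⨆ (_ : q ≠ p), G q) ≤ LinearMap.ker (π p) :=
    iSup₂_le fun q hq y hy => h2 p q hq y hy
  rw [← h1 p x hx]
  exact hk hx'

/-- The projection onto the component of degree `p` of a graded vector space. -/
def proj {M : Type u} [AddCommGroup M] [Module ℚ M] {G : ℤ → Submodule ℚ M}
    (hG : DirectSum.IsInternal G) (p : ℤ) : M →ₗ[ℚ] M :=
  letI := hG.chooseDecomposition
  (G p).subtype ∘ₗ DirectSum.component ℚ ℤ (fun i => G i) p ∘ₗ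
    (DirectSum.decomposeLinearEquiv G).toLinearMap

theorem proj_of_mem {M : Type u} [AddCommGroup M] [Module ℚ M] {G : ℤ → Submodule ℚ M}
    (hG : DirectSum.IsInternal G) {p : ℤ} {x : M} (hx : x ∈ G p) : proj hG p x = x :=
  letI := hG.chooseDecomposition
  DirectSum.decompose_of_mem_same G hx

theorem proj_of_mem_ne {M : Type u} [AddCommGroup M] [Module ℚ M] {G : ℤ → Submodule ℚ M}
    (hG : DirectSum.IsInternal G) {p q : ℤ} (h : q ≠ p) {x : M} (hx : x ∈ G q) :
    proj hG p x = 0 :=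
  letI := hG.chooseDecomposition
  DirectSum.decompose_of_mem_ne G hx h

theorem exists_sum_proj {M : Type u} [AddCommGroup M] [Module ℚ M] {G : ℤ → Submodule ℚ M}
    (hG : DirectSum.IsInternal G) (x : M) : ∃ s : Finset ℤ, ∑ p ∈ s, proj hG p x = x := by
  classical
  let := hG.chooseDecomposition
  exact ⟨_, DirectSum.sum_support_decompose G x⟩

/-- Two linear maps that agree on homogeneous elements are equal. -/
theorem homogeneous_induction {M : Type u} [AddCommGroup M] [Module ℚ M]
    {G : ℤ → Submodule ℚ M} (hG : DirectSum.IsInternal G) {N : Type v} [AddCommGroup N]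
    [Module ℚ N] {f g : M →ₗ[ℚ] N} (h : ∀ p, ∀ x ∈ G p, f x = g x) (x : M) : f x = g x := by
  have : (⊤ : Submodule ℚ M) ≤ LinearMap.eqLocus f g := by
    rw [← hG.submodule_iSup_eq_top]
    exact iSup_le fun p x hx => h p x hx
  exact this (Submodule.mem_top : x ∈ ⊤)

theorem proj_mem {M : Type u} [AddCommGroup M] [Module ℚ M] {G : ℤ → Submodule ℚ M}
    (hG : DirectSum.IsInternal G) (p : ℤ) (x : M) : proj hG p x ∈ G p :=
  Subtype.prop _

/-! ### Cohomology of a differential vector space -/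

/-- The cohomology `ker d / im d` of a differential vector space `(M, d)`. -/
def Cohomology {M : Type u} [AddCommGroup M] [Module ℚ M] (d : M →ₗ[ℚ] M) : Type u :=
  LinearMap.ker d ⧸ (LinearMap.range d).submoduleOf (LinearMap.ker d)

namespace Cohomology

variable {M : Type u} [AddCommGroup M] [Module ℚ M] {N : Type v} [AddCommGroup N] [Module ℚ N]

instance (d : M →ₗ[ℚ] M) : AddCommGroup (Cohomology d) :=
  inferInstanceAs (AddCommGroup (LinearMap.ker d ⧸ (LinearMap.range d).submoduleOf _))

instance (d : M →ₗ[ℚ] M) : Module ℚ (Cohomology d) :=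
  inferInstanceAs (Module ℚ (LinearMap.ker d ⧸ (LinearMap.range d).submoduleOf _))

/-- The class of a cocycle. -/
def cls (d : M →ₗ[ℚ] M) : LinearMap.ker d →ₗ[ℚ] Cohomology d :=
  Submodule.mkQ _

theorem cls_surjective (d : M →ₗ[ℚ] M) : Function.Surjective (cls d) :=
  Submodule.mkQ_surjective _

theorem cls_eq_zero {d : M →ₗ[ℚ] M} (z : LinearMap.ker d) :
    cls d z = 0 ↔ ∃ x, d x = z := by
  exact Submodule.Quotient.mk_eq_zero _

/-- The map induced in cohomology by a linear map that commutes with the differentials. -/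
def map {d : M →ₗ[ℚ] M} {d' : N →ₗ[ℚ] N} (f : M →ₗ[ℚ] N) (hf : ∀ x, f (d x) = d' (f x)) :
    Cohomology d →ₗ[ℚ] Cohomology d' :=
  Submodule.mapQ _ _
    (f.restrict (p := LinearMap.ker d) (q := LinearMap.ker d') fun x hx => by
      rw [LinearMap.mem_ker] at hx ⊢; rw [← hf, hx, map_zero])
    (by
      rintro ⟨x, hx⟩ ⟨y, hy⟩
      exact ⟨f y, by rw [← hf, hy]; rfl⟩)

theorem map_cls {d : M →ₗ[ℚ] M} {d' : N →ₗ[ℚ] N} (f : M →ₗ[ℚ] N)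
    (hf : ∀ x, f (d x) = d' (f x)) (z : LinearMap.ker d) (hz : f z ∈ LinearMap.ker d') :
    map f hf (cls d z) = cls d' ⟨f z, hz⟩ := rfl

end Cohomology

/-! ### Commutative graded algebras and commutative cochain algebras -/

/-- A commutative graded algebra over `ℚ`. -/
structure CGA where
  carrier : Type u
  [ring : Ring carrier]
  [algebra : Algebra ℚ carrier]
  gr : ℤ → Submodule ℚ carrier
  [graded : GradedAlgebra gr]
  comm : ∀ {p q : ℤ} {a b : carrier}, a ∈ gr p → b ∈ gr q →
    a * b = ((-1 : ℚ) ^ (p * q)) • (b * a)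

attribute [instance] CGA.ring CGA.algebra CGA.graded

/-- A commutative cochain algebra over `ℚ`: a commutative graded algebra concentrated in
non-negative degrees, with a differential of degree `1` that is a derivation. -/
structure CDGA extends CGA.{u} where
  gr_neg : ∀ p : ℤ, p < 0 → gr p = ⊥
  d : carrier →ₗ[ℚ] carrier
  d_mem : ∀ {p : ℤ} {a : carrier}, a ∈ gr p → d a ∈ gr (p + 1)
  d_d : ∀ a, d (d a) = 0
  leibniz : ∀ {p : ℤ} {a : carrier}, a ∈ gr p → ∀ b : carrier,
    d (a * b) = d a * b + ((-1 : ℚ) ^ p) • (a * d b)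

instance : CoeSort CGA.{u} (Type u) := ⟨CGA.carrier⟩
instance : CoeSort CDGA.{u} (Type u) := ⟨fun A => A.carrier⟩

/-- A Poincaré duality algebra: a finite dimensional commutative graded algebra `H` with `H⁰ = ℚ`,
concentrated in degrees `0 ≤ p ≤ n`, with a class `Ω` spanning `Hⁿ` such that the map
`a ↦ (b ↦ Ω♯(a b))` from `H` to `Hom(H, ℚ)` is an isomorphism. -/
def CGA.IsPoincareDualityAlgebra (H : CGA.{u}) : Prop :=
  FiniteDimensional ℚ H ∧ Nontrivial H ∧ H.gr 0 = Submodule.span ℚ {1} ∧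
  ∃ n : ℕ, (∀ p : ℤ, p < 0 ∨ (n : ℤ) < p → H.gr p = ⊥) ∧
    ∃ Ω ∈ H.gr n, H.gr n = Submodule.span ℚ {Ω} ∧
      ∃ Ωsharp : H →ₗ[ℚ] ℚ, Ωsharp Ω = 1 ∧ (∀ p : ℤ, p ≠ n → ∀ x ∈ H.gr p, Ωsharp x = 0) ∧
        Function.Bijective fun a : H => Ωsharp ∘ₗ LinearMap.mulLeft ℚ a

namespace CDGA

variable (A : CDGA.{u})

theorem internal : DirectSum.IsInternal A.gr := DirectSum.Decomposition.isInternal A.gr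

/-- The degree involution `a ↦ (-1)^|a| a`. -/
def eps : A →ₗ[ℚ] A :=
  DirectSum.toModule ℚ ℤ A (fun p => ((-1 : ℚ) ^ p) • (A.gr p).subtype) ∘ₗ
    (DirectSum.decomposeLinearEquiv A.gr).toLinearMap

theorem eps_of_mem {p : ℤ} {a : A} (ha : a ∈ A.gr p) : A.eps a = ((-1 : ℚ) ^ p) • a := by
  have h : DirectSum.decomposeLinearEquiv A.gr a =
      DirectSum.lof ℚ ℤ (fun i => A.gr i) p ⟨a, ha⟩ := DirectSum.decompose_of_mem _ ha
  simp [eps, h]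

theorem d_mul (a b : A) : A.d (a * b) = A.d a * b + A.eps a * A.d b := by
  refine homogeneous_induction A.internal
    (f := A.d ∘ₗ (LinearMap.mul ℚ A).flip b)
    (g := (LinearMap.mul ℚ A).flip b ∘ₗ A.d + (LinearMap.mul ℚ A).flip (A.d b) ∘ₗ A.eps) ?_ a
  intro p x hx
  simp [A.leibniz hx, A.eps_of_mem hx]

theorem eps_eps (a : A) : A.eps (A.eps a) = a := by
  refine homogeneous_induction A.internal (f := A.eps ∘ₗ A.eps) (g := LinearMap.id) ?_ a
  intro p x hx
  simp only [LinearMap.comp_apply, A.eps_of_mem hx, map_smul, smul_smul, LinearMap.id_apply,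
    ← mul_zpow]
  simp

theorem d_eps (a : A) : A.d (A.eps a) = - A.eps (A.d a) := by
  refine homogeneous_induction A.internal (f := A.d ∘ₗ A.eps) (g := - (A.eps ∘ₗ A.d)) ?_ a
  intro p x hx
  simp [A.eps_of_mem hx, A.eps_of_mem (A.d_mem hx), zpow_add₀]

theorem eps_mul (a b : A) : A.eps (a * b) = A.eps a * A.eps b := by
  refine homogeneous_induction A.internal (f := A.eps ∘ₗ (LinearMap.mul ℚ A).flip b)
    (g := (LinearMap.mul ℚ A).flip (A.eps b) ∘ₗ A.eps) ?_ a
  intro p x hx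
  refine homogeneous_induction A.internal (f := A.eps ∘ₗ LinearMap.mul ℚ A x)
    (g := LinearMap.mul ℚ A (A.eps x) ∘ₗ A.eps) ?_ b
  intro q y hy
  simp [A.eps_of_mem hx, A.eps_of_mem hy, A.eps_of_mem (SetLike.GradedMul.mul_mem hx hy),
    zpow_add₀, smul_smul]

theorem d_one : A.d 1 = 0 := by
  have h := A.leibniz (SetLike.GradedOne.one_mem : (1 : A) ∈ A.gr 0) 1
  simpa using h

theorem proj_d (p : ℤ) (a : A) : proj A.internal (p + 1) (A.d a) = A.d (proj A.internal p a) := by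
  refine homogeneous_induction A.internal (f := proj A.internal (p + 1) ∘ₗ A.d)
    (g := A.d ∘ₗ proj A.internal p) ?_ a
  intro q x hx
  by_cases h : q = p
  · subst h
    simp [proj_of_mem _ hx, proj_of_mem _ (A.d_mem hx)]
  · simp [proj_of_mem_ne _ h hx, proj_of_mem_ne _ (show q + 1 ≠ p + 1 by omega) (A.d_mem hx)]

/-! ### The cohomology algebra -/

/-- The underlying vector space of the cohomology algebra `H(A, d)`. -/
abbrev H : Type u := Cohomology A.d

theorem mul_mem_ker {a b : A} (ha : A.d a = 0) (hb : A.d b = 0) : A.d (a * b) = 0 := by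
  rw [d_mul, ha, hb, zero_mul, mul_zero, add_zero]

/-- The product of cocycles. -/
def mulZ : LinearMap.ker A.d →ₗ[ℚ] LinearMap.ker A.d →ₗ[ℚ] LinearMap.ker A.d :=
  LinearMap.mk₂ ℚ (fun a b => ⟨a.1 * b.1, A.mul_mem_ker a.2 b.2⟩)
    (fun _ _ _ => Subtype.ext (add_mul _ _ _)) (fun _ _ _ => Subtype.ext (smul_mul_assoc _ _ _))
    (fun _ _ _ => Subtype.ext (mul_add _ _ _)) (fun _ _ _ => Subtype.ext (mul_smul_comm _ _ _))

theorem cls_mulZ_left {a b : LinearMap.ker A.d} (h : Cohomology.cls A.d a = 0) :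
    Cohomology.cls A.d (A.mulZ a b) = 0 := by
  obtain ⟨x, hx⟩ := (Cohomology.cls_eq_zero a).1 h
  refine (Cohomology.cls_eq_zero _).2 ⟨x * b, ?_⟩
  rw [d_mul, hx, show A.d (b : A) = 0 from b.2, mul_zero, add_zero]
  rfl

theorem cls_mulZ_right {a b : LinearMap.ker A.d} (h : Cohomology.cls A.d b = 0) :
    Cohomology.cls A.d (A.mulZ a b) = 0 := by
  obtain ⟨x, hx⟩ := (Cohomology.cls_eq_zero b).1 h
  refine (Cohomology.cls_eq_zero _).2 ⟨A.eps a * x, ?_⟩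
  rw [d_mul, hx, d_eps, show A.d (a : A) = 0 from a.2, map_zero, neg_zero, zero_mul, zero_add,
    eps_eps]
  rfl

/-- The product `[a] [b] = [a b]` of cohomology classes. -/
def mulH : A.H →ₗ[ℚ] A.H →ₗ[ℚ] A.H :=
  Submodule.liftQ _
    { toFun := fun a => Submodule.liftQ _ (Cohomology.cls A.d ∘ₗ A.mulZ a) (fun b hb =>
        A.cls_mulZ_right ((Submodule.Quotient.mk_eq_zero _).2 hb))
      map_add' := fun a b => by
        apply LinearMap.ext; intro c
        obtain ⟨c, rfl⟩ := Cohomology.cls_surjective _ c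
        change Cohomology.cls A.d (A.mulZ (a + b) c) =
          Cohomology.cls A.d (A.mulZ a c) + Cohomology.cls A.d (A.mulZ b c)
        rw [map_add, LinearMap.add_apply, map_add]
      map_smul' := fun r a => by
        apply LinearMap.ext; intro c
        obtain ⟨c, rfl⟩ := Cohomology.cls_surjective _ c
        change Cohomology.cls A.d (A.mulZ (r • a) c) = r • Cohomology.cls A.d (A.mulZ a c)
        rw [map_smul, LinearMap.smul_apply, map_smul] }
    (fun a ha => by
      apply LinearMap.ext; intro c
      obtain ⟨c, rfl⟩ := Cohomology.cls_surjective _ c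
      exact A.cls_mulZ_left ((Submodule.Quotient.mk_eq_zero _).2 ha))

theorem mulH_cls (a b : LinearMap.ker A.d) :
    A.mulH (Cohomology.cls A.d a) (Cohomology.cls A.d b) = Cohomology.cls A.d (A.mulZ a b) := rfl

instance : Ring A.H :=
  { (inferInstance : AddCommGroup A.H) with
    mul := fun a b => A.mulH a b
    one := Cohomology.cls A.d ⟨1, A.d_one⟩
    left_distrib := fun a b c => map_add (A.mulH a) b c
    right_distrib := fun a b c => LinearMap.map_add₂ A.mulH a b c
    zero_mul := fun a => LinearMap.map_zero₂ A.mulH a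
    mul_zero := fun a => map_zero (A.mulH a)
    mul_assoc := fun a b c => by
      obtain ⟨a, rfl⟩ := Cohomology.cls_surjective _ a
      obtain ⟨b, rfl⟩ := Cohomology.cls_surjective _ b
      obtain ⟨c, rfl⟩ := Cohomology.cls_surjective _ c
      exact congrArg (Cohomology.cls A.d) (Subtype.ext (mul_assoc _ _ _))
    one_mul := fun a => by
      obtain ⟨a, rfl⟩ := Cohomology.cls_surjective _ a
      exact congrArg (Cohomology.cls A.d) (Subtype.ext (one_mul _))
    mul_one := fun a => by
      obtain ⟨a, rfl⟩ := Cohomology.cls_surjective _ a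
      exact congrArg (Cohomology.cls A.d) (Subtype.ext (mul_one _)) }

theorem cls_mul (a b : LinearMap.ker A.d) :
    Cohomology.cls A.d a * Cohomology.cls A.d b = Cohomology.cls A.d (A.mulZ a b) := rfl

instance : Algebra ℚ A.H :=
  Algebra.ofModule (fun r a b => LinearMap.map_smul₂ A.mulH r a b)
    (fun r a b => map_smul (A.mulH a) r b)

/-- `Hᵖ(A, d)`: the classes of the cocycles of degree `p`. -/
def grH (p : ℤ) : Submodule ℚ A.H :=
  ((A.gr p).comap (LinearMap.ker A.d).subtype).map (Cohomology.cls A.d)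

theorem internalH : DirectSum.IsInternal A.grH := by
  have hz : ∀ p, ∀ z ∈ LinearMap.ker A.d, proj A.internal p z ∈ LinearMap.ker A.d := by
    intro p z hz
    rw [LinearMap.mem_ker] at hz ⊢
    rw [← proj_d, hz, map_zero]
  refine isInternal_of_proj A.grH
    (fun p => Submodule.mapQ _ _ ((proj A.internal p).restrict (hz p)) ?_) ?_ ?_ ?_
  · rintro ⟨x, hx⟩ ⟨y, hy⟩
    refine ⟨proj A.internal (p - 1) y, ?_⟩
    rw [← proj_d, sub_add_cancel, hy]; rfl
  · rintro p _ ⟨z, hz, rfl⟩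
    exact congrArg (Cohomology.cls A.d) (Subtype.ext (proj_of_mem A.internal hz))
  · rintro p q hpq _ ⟨z, hz, rfl⟩
    refine (congrArg (Cohomology.cls A.d) (Subtype.ext
      (proj_of_mem_ne A.internal hpq hz) : _ = (0 : LinearMap.ker A.d))).trans (map_zero _)
  · rw [eq_top_iff]
    rintro x -
    obtain ⟨z, rfl⟩ := Cohomology.cls_surjective _ x
    obtain ⟨s, hs⟩ := exists_sum_proj A.internal (z : A)
    have h : z = ∑ p ∈ s, (⟨proj A.internal p z, hz p _ z.2⟩ : LinearMap.ker A.d) := by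
      apply Subtype.ext
      rw [AddSubmonoidClass.coe_finsetSum]
      exact hs.symm
    rw [h, map_sum]
    refine Submodule.sum_mem _ fun p _ => ?_
    exact Submodule.mem_iSup_of_mem p ⟨_, proj_mem A.internal p _, rfl⟩

instance : GradedAlgebra A.grH where
  one_mem := ⟨⟨1, A.d_one⟩, (SetLike.GradedOne.one_mem : (1 : A) ∈ A.gr 0), rfl⟩
  mul_mem := by
    rintro p q _ _ ⟨a, ha, rfl⟩ ⟨b, hb, rfl⟩
    exact ⟨A.mulZ a b, (SetLike.GradedMul.mul_mem ha hb : (a * b : A) ∈ A.gr (p + q)), rfl⟩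
  toDecomposition := A.internalH.chooseDecomposition

/-- The cohomology algebra `H(A, d)` of a commutative cochain algebra. -/
def cohomology : CGA.{u} where
  carrier := A.H
  gr := A.grH
  comm := by
    rintro p q _ _ ⟨a, ha, rfl⟩ ⟨b, hb, rfl⟩
    rw [cls_mul, cls_mul, ← map_smul]
    exact congrArg (Cohomology.cls A.d) (Subtype.ext (A.comm ha hb))

/-- A morphism of commutative cochain algebras. -/
structure Hom (A : CDGA.{u}) (B : CDGA.{v}) where
  toAlgHom : A →ₐ[ℚ] B
  map_gr : ∀ {p : ℤ} {a : A}, a ∈ A.gr p → toAlgHom a ∈ B.gr p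
  map_d : ∀ a, toAlgHom (A.d a) = B.d (toAlgHom a)

/-- `H(f)` is an isomorphism. -/
def Hom.IsQuasiIso {A : CDGA.{u}} {B : CDGA.{v}} (f : Hom A B) : Prop :=
  Function.Bijective (Cohomology.map (d := A.d) (d' := B.d) f.toAlgHom.toLinearMap f.map_d)

end CDGA

/-! ### Differential modules -/

/-- A differential module over `(A, d)`. -/
structure DGModule (A : CDGA.{u}) where
  carrier : Type v
  [addCommGroup : AddCommGroup carrier]
  [moduleRat : Module ℚ carrier]
  [module : Module A carrier]
  [tower : IsScalarTower ℚ A carrier]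
  gr : ℤ → Submodule ℚ carrier
  internal : DirectSum.IsInternal gr
  smul_mem : ∀ {p q : ℤ} {a : A} {m : carrier}, a ∈ A.gr p → m ∈ gr q → a • m ∈ gr (p + q)
  d : carrier →ₗ[ℚ] carrier
  d_mem : ∀ {p : ℤ} {m : carrier}, m ∈ gr p → d m ∈ gr (p + 1)
  d_d : ∀ m, d (d m) = 0
  leibniz : ∀ {p : ℤ} {a : A}, a ∈ A.gr p → ∀ m : carrier,
    d (a • m) = A.d a • m + ((-1 : ℚ) ^ p) • (a • d m)

attribute [instance] DGModule.addCommGroup DGModule.moduleRat DGModule.module DGModule.tower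

instance (A : CDGA.{u}) : CoeSort (DGModule.{u, v} A) (Type v) := ⟨DGModule.carrier⟩

namespace DGModule

variable {A : CDGA.{u}}

/-- A morphism of `(A, d)`-modules (of degree `0`). -/
structure Hom (M : DGModule.{u, v} A) (N : DGModule.{u, w} A) where
  toLinearMap : M →ₗ[A] N
  map_gr : ∀ {p : ℤ} {m : M}, m ∈ M.gr p → toLinearMap m ∈ N.gr p
  map_d : ∀ m, toLinearMap (M.d m) = N.d (toLinearMap m)

/-- The map `H(f)` induced in cohomology by a morphism of `(A, d)`-modules. -/
def Hom.H {M : DGModule.{u, v} A} {N : DGModule.{u, w} A} (f : Hom M N) :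
    Cohomology M.d →ₗ[ℚ] Cohomology N.d :=
  Cohomology.map (f.toLinearMap.restrictScalars ℚ) f.map_d

/-- `H(f)` is an isomorphism. -/
def Hom.IsQuasiIso {M : DGModule.{u, v} A} {N : DGModule.{u, w} A} (f : Hom M N) : Prop :=
  Function.Bijective f.H

/-- `f : M → N` admits a homotopy retraction: there are an `(A, d)`-module `P`, a
quasi-isomorphism `ψ : P → N` and morphisms `j : M → P`, `ρ : P → M` with `ψ j = f` and
`ρ j = id`. -/
def Hom.HasHomotopyRetraction {M N : DGModule.{u, u} A} (f : Hom M N) : Prop :=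
  ∃ (P : DGModule.{u, u} A) (j : Hom M P) (ψ : Hom P N) (ρ : Hom P M), ψ.IsQuasiIso ∧
    (∀ m, ψ.toLinearMap (j.toLinearMap m) = f.toLinearMap m) ∧
    (∀ m, ρ.toLinearMap (j.toLinearMap m) = m)

/-- A differential graded submodule. -/
structure Sub (M : DGModule.{u, v} A) where
  toSubmodule : Submodule A M
  homogeneous : toSubmodule.restrictScalars ℚ ≤ ⨆ p, toSubmodule.restrictScalars ℚ ⊓ M.gr p
  d_mem : ∀ {m : M}, m ∈ toSubmodule → M.d m ∈ toSubmodule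

/-- The quotient of a differential module by a differential graded submodule. -/
def quotient (M : DGModule.{u, v} A) (N : Sub M) : DGModule.{u, v} A where
  carrier := M ⧸ N.toSubmodule
  gr p := (M.gr p).map (N.toSubmodule.mkQ.restrictScalars ℚ)
  internal := by
    have hN : ∀ p, N.toSubmodule.restrictScalars ℚ ≤
        (N.toSubmodule.restrictScalars ℚ).comap (proj M.internal p) := by
      intro p
      refine N.homogeneous.trans (iSup_le fun q => ?_)
      rintro x ⟨hx, hq⟩
      by_cases h : q = p
      · subst h; simpa [proj_of_mem M.internal hq] using hx
      · simp [proj_of_mem_ne M.internal h hq]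
    refine isInternal_of_proj _ (fun p =>
      (Submodule.mapQ (N.toSubmodule.restrictScalars ℚ) (N.toSubmodule.restrictScalars ℚ)
        (proj M.internal p) (hN p) :
          (M ⧸ N.toSubmodule) →ₗ[ℚ] (M ⧸ N.toSubmodule))) ?_ ?_ ?_
    · rintro p _ ⟨x, hx, rfl⟩
      exact congrArg N.toSubmodule.mkQ (proj_of_mem M.internal hx)
    · rintro p q h _ ⟨x, hx, rfl⟩
      exact (congrArg N.toSubmodule.mkQ (proj_of_mem_ne M.internal h hx)).trans (map_zero _)
    · rw [← Submodule.map_iSup, M.internal.submodule_iSup_eq_top, Submodule.map_top,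
        LinearMap.range_eq_top]
      exact N.toSubmodule.mkQ_surjective
  smul_mem := by
    rintro p q a _ ha ⟨m, hm, rfl⟩
    exact ⟨a • m, M.smul_mem ha hm, rfl⟩
  d := (Submodule.mapQ (N.toSubmodule.restrictScalars ℚ) (N.toSubmodule.restrictScalars ℚ) M.d
    (fun _ hm => N.d_mem hm) : (M ⧸ N.toSubmodule) →ₗ[ℚ] (M ⧸ N.toSubmodule))
  d_mem := by
    rintro p _ ⟨m, hm, rfl⟩
    exact ⟨M.d m, M.d_mem hm, rfl⟩
  d_d := by
    intro x
    obtain ⟨m, rfl⟩ := N.toSubmodule.mkQ_surjective x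
    exact (congrArg N.toSubmodule.mkQ (M.d_d m)).trans (map_zero _)
  leibniz := by
    intro p a ha x
    obtain ⟨m, rfl⟩ := N.toSubmodule.mkQ_surjective x
    exact congrArg N.toSubmodule.mkQ (M.leibniz ha m)

/-- The projection onto a quotient module. -/
def quotientMap (M : DGModule.{u, v} A) (N : Sub M) : Hom M (M.quotient N) where
  toLinearMap := N.toSubmodule.mkQ
  map_gr := fun {_ m} hm => ⟨m, hm, rfl⟩
  map_d := fun _ => rfl

end DGModule

namespace CDGA

variable (A : CDGA.{u})

/-- `(A, d)` as a differential module over itself. -/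
def self : DGModule.{u, u} A where
  carrier := A
  gr := A.gr
  internal := A.internal
  smul_mem := fun ha hm => SetLike.GradedMul.mul_mem ha hm
  d := A.d
  d_mem := A.d_mem
  d_d := A.d_d
  leibniz := A.leibniz

/-- A differential graded (left) ideal. -/
structure DGIdeal where
  toIdeal : Ideal A
  homogeneous : toIdeal.restrictScalars ℚ ≤ ⨆ p, toIdeal.restrictScalars ℚ ⊓ A.gr p
  d_mem : ∀ {a : A}, a ∈ toIdeal → A.d a ∈ toIdeal

variable {A}

/-- The kernel of a morphism of commutative cochain algebras. -/
def Hom.ker {B : CDGA.{v}} (f : Hom A B) : A.DGIdeal where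
  toIdeal := RingHom.ker f.toAlgHom
  homogeneous := by
    intro x hx
    have key : ∀ p, f.toAlgHom (proj A.internal p x) = proj B.internal p (f.toAlgHom x) := by
      intro p
      refine homogeneous_induction A.internal (f := f.toAlgHom.toLinearMap ∘ₗ proj A.internal p)
        (g := proj B.internal p ∘ₗ f.toAlgHom.toLinearMap) ?_ x
      intro q y hy
      by_cases h : q = p
      · subst h
        simp [proj_of_mem _ hy, proj_of_mem _ (f.map_gr hy)]
      · simp [proj_of_mem_ne _ h hy, proj_of_mem_ne _ h (f.map_gr hy)]
    obtain ⟨s, hs⟩ := exists_sum_proj A.internal x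
    rw [← hs]
    refine Submodule.sum_mem _ fun p _ => Submodule.mem_iSup_of_mem p ⟨?_, proj_mem A.internal p x⟩
    change f.toAlgHom (proj A.internal p x) = 0
    rw [key, show f.toAlgHom x = 0 from hx, map_zero]
  d_mem := by
    intro x hx
    change f.toAlgHom (A.d x) = 0
    rw [f.map_d, show f.toAlgHom x = 0 from hx, map_zero]

/-- The `n`-th power `Iⁿ` of a differential ideal. -/
def DGIdeal.pow (I : A.DGIdeal) (n : ℕ) : A.DGIdeal where
  toIdeal := I.toIdeal ^ n
  homogeneous := by
    induction n with
    | zero =>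
      intro x _
      have h : x ∈ ⨆ p, A.gr p := by
        rw [A.internal.submodule_iSup_eq_top]; exact Submodule.mem_top
      refine (iSup_mono fun p => ?_ : ⨆ p, A.gr p ≤ _) h
      intro y hy
      refine ⟨?_, hy⟩
      change y ∈ I.toIdeal ^ 0
      rw [Submodule.pow_zero, Ideal.one_eq_top]
      exact Submodule.mem_top
    | succ n ih =>
      intro x hx
      change x ∈ I.toIdeal ^ (n + 1) at hx
      rw [Submodule.pow_succ] at hx
      refine Submodule.mul_induction_on hx ?_ (fun _ _ => Submodule.add_mem _)
      intro a ha b hb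
      refine Submodule.iSup_induction _ (motive := fun a => (a * b : A) ∈ _) (ih ha) ?_ ?_ ?_
      · rintro p a ⟨ha, hap⟩
        refine Submodule.iSup_induction _ (motive := fun b => (a * b : A) ∈ _)
          (I.homogeneous hb) ?_ ?_ ?_
        · rintro q b ⟨hb, hbq⟩
          refine Submodule.mem_iSup_of_mem (p + q) ⟨?_, SetLike.GradedMul.mul_mem hap hbq⟩
          change a * b ∈ I.toIdeal ^ (n + 1)
          rw [Submodule.pow_succ]
          exact Submodule.mul_mem_mul ha hb
        · rw [mul_zero]; exact Submodule.zero_mem _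
        · intro b c hb hc; rw [mul_add]; exact Submodule.add_mem _ hb hc
      · rw [zero_mul]; exact Submodule.zero_mem _
      · intro b c hb hc; rw [add_mul]; exact Submodule.add_mem _ hb hc
  d_mem := by
    have key : (∀ {a : A}, a ∈ I.toIdeal ^ n → A.d a ∈ I.toIdeal ^ n) ∧
        (∀ {a : A}, a ∈ I.toIdeal ^ n → A.eps a ∈ I.toIdeal ^ n) := by
      have heI : ∀ {a : A}, a ∈ I.toIdeal → A.eps a ∈ I.toIdeal := by
        intro a ha
        refine Submodule.iSup_induction _ (motive := fun a => A.eps a ∈ I.toIdeal)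
          (I.homogeneous ha) ?_ ?_ ?_
        · rintro p a ⟨ha, hap⟩
          rw [A.eps_of_mem hap]
          exact (I.toIdeal.restrictScalars ℚ).smul_mem _ ha
        · rw [map_zero]; exact Submodule.zero_mem _
        · intro b c hb hc; rw [map_add]; exact Submodule.add_mem _ hb hc
      induction n with
      | zero =>
        rw [Submodule.pow_zero, Ideal.one_eq_top]
        exact ⟨fun _ => Submodule.mem_top, fun _ => Submodule.mem_top⟩
      | succ n ih =>
        rw [Submodule.pow_succ]
        constructor
        · intro x hx
          refine Submodule.mul_induction_on hx ?_ ?_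
          · intro a ha b hb
            rw [d_mul]
            exact Submodule.add_mem _ (Submodule.mul_mem_mul (ih.1 ha) hb)
              (Submodule.mul_mem_mul (ih.2 ha) (I.d_mem hb))
          · intro b c hb hc; rw [map_add]; exact Submodule.add_mem _ hb hc
        · intro x hx
          refine Submodule.mul_induction_on hx ?_ ?_
          · intro a ha b hb
            rw [eps_mul]
            exact Submodule.mul_mem_mul (ih.2 ha) (heI hb)
          · intro b c hb hc; rw [map_add]; exact Submodule.add_mem _ hb hc
    intro a ha
    exact key.1 ha

/-- A differential ideal as a differential submodule. -/
def DGIdeal.toSub (I : A.DGIdeal) : A.self.Sub where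
  toSubmodule := I.toIdeal
  homogeneous := I.homogeneous
  d_mem := I.d_mem

end CDGA

/-! ### Tensor products of commutative cochain algebras -/

section Tensor

variable (A : CDGA.{u}) (B : CDGA.{v})

/-- The underlying algebra of `A ⊗ B`, with product
`(a ⊗ b)(a' ⊗ b') = (-1)^(|b||a'|) aa' ⊗ bb'`. -/
abbrev TensorCarrier : Type (max u v) := A.gr ᵍ⊗[ℚ] B.gr

instance : SMulCommClass ℚ (TensorCarrier A B) (TensorCarrier A B) :=
  ⟨fun r x y => (Algebra.mul_smul_comm r x y).symm⟩

/-- The element `a ⊗ b`. -/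
def tmk : A →ₗ[ℚ] B →ₗ[ℚ] TensorCarrier A B :=
  (TensorProduct.mk ℚ A B).compr₂ (GradedTensorProduct.of ℚ A.gr B.gr).toLinearMap

theorem units_smul_eq {M : Type u} [AddCommGroup M] [Module ℚ M] (n : ℤ) (x : M) :
    ((-1 : ℤˣ) ^ n) • x = ((-1 : ℚ) ^ n) • x := by
  rcases Int.even_or_odd n with h | h
  · rw [h.neg_one_zpow, h.neg_one_zpow, one_smul, one_smul]
  · rw [h.neg_one_zpow, h.neg_one_zpow, Units.neg_smul, neg_smul, one_smul, one_smul]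

theorem tmk_mul_tmk {q p : ℤ} (a : A) {b : B} (hb : b ∈ B.gr q) {a' : A} (ha' : a' ∈ A.gr p)
    (b' : B) : tmk A B a b * tmk A B a' b' =
      ((-1 : ℚ) ^ (q * p)) • tmk A B (a * a') (b * b') := by
  have h := GradedTensorProduct.tmul_coe_mul_coe_tmul (R := ℚ) A.gr B.gr a ⟨b, hb⟩ ⟨a', ha'⟩ b'
  refine h.trans ?_
  exact units_smul_eq _ _

/-- The component of degree `n` of `A ⊗ B`, spanned by the `a ⊗ b` with `|a| + |b| = n`. -/
def tensorGr (n : ℤ) : Submodule ℚ (TensorCarrier A B) :=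
  Submodule.span ℚ {x | ∃ p q : ℤ, p + q = n ∧ ∃ a ∈ A.gr p, ∃ b ∈ B.gr q, x = tmk A B a b}

theorem tmk_mem {p q : ℤ} {a : A} {b : B} (ha : a ∈ A.gr p) (hb : b ∈ B.gr q) :
    tmk A B a b ∈ tensorGr A B (p + q) :=
  Submodule.subset_span ⟨p, q, rfl, a, ha, b, hb, rfl⟩

/-- Two linear maps on `A ⊗ B` that agree on tensors of homogeneous elements are equal. -/
theorem tensor_induction {M : Type w} [AddCommGroup M] [Module ℚ M]
    {f g : TensorCarrier A B →ₗ[ℚ] M}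
    (h : ∀ p q, ∀ a ∈ A.gr p, ∀ b ∈ B.gr q, f (tmk A B a b) = g (tmk A B a b))
    (x : TensorCarrier A B) : f x = g x := by
  suffices f = g by rw [this]
  apply GradedTensorProduct.hom_ext
  apply TensorProduct.ext'
  intro a b
  refine homogeneous_induction A.internal (f := f ∘ₗ (tmk A B).flip b)
    (g := g ∘ₗ (tmk A B).flip b) ?_ a
  intro p a ha
  exact homogeneous_induction B.internal (f := f ∘ₗ tmk A B a) (g := g ∘ₗ tmk A B a)
    (fun q b hb => h p q a ha b hb) b

/-- The linear map on `A ⊗ B` induced by a bilinear map. -/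
def tensorLift {M : Type w} [AddCommGroup M] [Module ℚ M] (f : A →ₗ[ℚ] B →ₗ[ℚ] M) :
    TensorCarrier A B →ₗ[ℚ] M :=
  TensorProduct.lift f ∘ₗ (GradedTensorProduct.of ℚ A.gr B.gr).symm.toLinearMap

theorem tensorLift_tmk {M : Type w} [AddCommGroup M] [Module ℚ M] (f : A →ₗ[ℚ] B →ₗ[ℚ] M)
    (a : A) (b : B) : tensorLift A B f (tmk A B a b) = f a b := by
  exact TensorProduct.lift.tmul a b

theorem tensor_iSup : ⨆ n, tensorGr A B n = ⊤ := by
  rw [← Submodule.ker_mkQ (⨆ n, tensorGr A B n), LinearMap.ker_eq_top]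
  apply LinearMap.ext
  refine tensor_induction A B fun p q a ha b hb => ?_
  rw [LinearMap.zero_apply, Submodule.mkQ_apply, Submodule.Quotient.mk_eq_zero]
  exact Submodule.mem_iSup_of_mem _ (tmk_mem A B ha hb)

theorem nonneg_of_ne_zero {A : CDGA.{u}} {p : ℤ} {a : A} (ha : a ∈ A.gr p) (h0 : a ≠ 0) :
    0 ≤ p := by
  by_contra h
  rw [A.gr_neg p (by omega), Submodule.mem_bot] at ha
  exact h0 ha

theorem tensor_internal : DirectSum.IsInternal (tensorGr A B) := by
  have key : ∀ n p q : ℤ, ∀ a ∈ A.gr p, ∀ b ∈ B.gr q,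
      tensorLift A B (∑ i ∈ Finset.Icc 0 n,
        (tmk A B).compl₁₂ (proj A.internal i) (proj B.internal (n - i))) (tmk A B a b) =
      if p + q = n then tmk A B a b else 0 := by
    intro n p q a ha b hb
    rw [tensorLift_tmk]
    simp only [LinearMap.sum_apply, LinearMap.compl₁₂_apply]
    by_cases ha0 : a = 0
    · simp [ha0]
    by_cases hb0 : b = 0
    · simp [hb0]
    have hp := nonneg_of_ne_zero ha ha0
    have hq := nonneg_of_ne_zero hb hb0
    split_ifs with h
    · rw [Finset.sum_eq_single p]
      · rw [proj_of_mem _ ha, show n - p = q by omega, proj_of_mem _ hb]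
      · intro i _ hi
        rw [proj_of_mem_ne _ hi.symm ha, map_zero, LinearMap.zero_apply]
      · intro hi
        exact absurd (Finset.mem_Icc.2 ⟨hp, by omega⟩) hi
    · refine Finset.sum_eq_zero fun i _ => ?_
      by_cases hi : p = i
      · rw [proj_of_mem_ne B.internal (show q ≠ n - i by omega) hb, map_zero]
      · rw [proj_of_mem_ne A.internal hi ha, map_zero, LinearMap.zero_apply]
  refine isInternal_of_proj _ (fun n => tensorLift A B (∑ i ∈ Finset.Icc 0 n,
        (tmk A B).compl₁₂ (proj A.internal i) (proj B.internal (n - i)))) ?_ ?_ (tensor_iSup A B)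
  · intro n x hx
    refine Submodule.span_induction ?_ (by simp) (fun x y _ _ hx hy => by rw [map_add, hx, hy])
      (fun r x _ hx => by rw [map_smul, hx]) hx
    rintro _ ⟨p, q, hpq, a, ha, b, hb, rfl⟩
    rw [key n p q a ha b hb, if_pos hpq]
  · intro n m hnm x hx
    refine Submodule.span_induction ?_ (by simp)
      (fun x y _ _ hx hy => by rw [map_add, hx, hy, add_zero])
      (fun r x _ hx => by rw [map_smul, hx, smul_zero]) hx
    rintro _ ⟨p, q, hpq, a, ha, b, hb, rfl⟩
    rw [key n p q a ha b hb, if_neg (by omega)]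

instance : GradedAlgebra (tensorGr A B) where
  one_mem := by
    have := tmk_mem A B (SetLike.GradedOne.one_mem : (1 : A) ∈ A.gr 0)
      (SetLike.GradedOne.one_mem : (1 : B) ∈ B.gr 0)
    rwa [add_zero] at this
  mul_mem := by
    intro m n x y hx hy
    refine Submodule.span_induction ?_ (by rw [zero_mul]; exact Submodule.zero_mem _)
      (fun x x' _ _ hx hx' => by rw [add_mul]; exact Submodule.add_mem _ hx hx')
      (fun r x _ hx => by rw [smul_mul_assoc]; exact Submodule.smul_mem _ _ hx) hx
    rintro _ ⟨p, q, hpq, a, ha, b, hb, rfl⟩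
    refine Submodule.span_induction ?_ (by rw [mul_zero]; exact Submodule.zero_mem _)
      (fun x x' _ _ hx hx' => by rw [mul_add]; exact Submodule.add_mem _ hx hx')
      (fun r x _ hx => by rw [mul_smul_comm]; exact Submodule.smul_mem _ _ hx) hy
    rintro _ ⟨p', q', hpq', a', ha', b', hb', rfl⟩
    rw [tmk_mul_tmk A B a hb ha' b', show m + n = (p + p') + (q + q') by omega]
    exact Submodule.smul_mem _ _ (tmk_mem A B (SetLike.GradedMul.mul_mem ha ha')
      (SetLike.GradedMul.mul_mem hb hb'))
  toDecomposition := (tensor_internal A B).chooseDecomposition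

/-- The differential `d(a ⊗ b) = da ⊗ b + (-1)^|a| a ⊗ db`. -/
def tensorD : TensorCarrier A B →ₗ[ℚ] TensorCarrier A B :=
  tensorLift A B ((tmk A B).compl₁₂ A.d LinearMap.id + (tmk A B).compl₁₂ A.eps B.d)

theorem tensorD_tmk (a : A) (b : B) :
    tensorD A B (tmk A B a b) = tmk A B (A.d a) b + tmk A B (A.eps a) (B.d b) := by
  rw [tensorD, tensorLift_tmk]
  simp

theorem sgn_mul_self (p : ℤ) : ((-1 : ℚ) ^ p) * ((-1 : ℚ) ^ p) = 1 := by
  rw [← mul_zpow]; simp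

/-- The tensor product of commutative cochain algebras. -/
def CDGA.tensor : CDGA.{max u v} where
  carrier := TensorCarrier A B
  gr := tensorGr A B
  comm := by
    intro m n x y hx hy
    refine Submodule.span_induction ?_ (by simp)
      (fun x x' _ _ hx hx' => by rw [add_mul, mul_add, smul_add, hx, hx'])
      (fun r x _ hx => by rw [smul_mul_assoc, mul_smul_comm, hx, smul_comm]) hx
    rintro _ ⟨p, q, hpq, a, ha, b, hb, rfl⟩
    refine Submodule.span_induction ?_ (by simp)
      (fun x x' _ _ hx hx' => by rw [add_mul, mul_add, smul_add, hx, hx'])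
      (fun r x _ hx => by rw [smul_mul_assoc, mul_smul_comm, hx, smul_comm]) hy
    rintro _ ⟨p', q', hpq', a', ha', b', hb', rfl⟩
    rw [tmk_mul_tmk A B a hb ha' b', tmk_mul_tmk A B a' hb' ha b, A.comm ha ha', B.comm hb hb']
    simp only [map_smul, LinearMap.smul_apply, smul_smul]
    congr 1
    subst hpq hpq'
    have h := sgn_mul_self (q' * p)
    simp only [add_mul, mul_add, zpow_add₀ (show (-1 : ℚ) ≠ 0 by norm_num), mul_comm p q',
      mul_comm p p', mul_comm q p'] at h ⊢
    linear_combination (-((-1 : ℚ) ^ (p' * q) * (-1 : ℚ) ^ (p' * p) * (-1 : ℚ) ^ (q * q'))) * h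
  gr_neg := by
    intro n hn
    rw [tensorGr, Submodule.span_eq_bot]
    rintro _ ⟨p, q, hpq, a, ha, b, hb, rfl⟩
    by_cases ha0 : a = 0
    · rw [ha0, map_zero, LinearMap.zero_apply]
    by_cases hb0 : b = 0
    · rw [hb0, map_zero]
    have hp := nonneg_of_ne_zero ha ha0
    have hq := nonneg_of_ne_zero hb hb0
    omega
  d := tensorD A B
  d_mem := by
    intro n x hx
    refine Submodule.span_induction ?_ (by simp)
      (fun x x' _ _ hx hx' => by rw [map_add]; exact Submodule.add_mem _ hx hx')
      (fun r x _ hx => by rw [map_smul]; exact Submodule.smul_mem _ _ hx) hx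
    rintro _ ⟨p, q, hpq, a, ha, b, hb, rfl⟩
    rw [tensorD_tmk, A.eps_of_mem ha, map_smul, LinearMap.smul_apply]
    refine Submodule.add_mem _ ?_ (Submodule.smul_mem _ _ ?_)
    · rw [show n + 1 = (p + 1) + q by omega]
      exact tmk_mem A B (A.d_mem ha) hb
    · rw [show n + 1 = p + (q + 1) by omega]
      exact tmk_mem A B ha (B.d_mem hb)
  d_d := by
    refine tensor_induction A B (f := tensorD A B ∘ₗ tensorD A B) (g := 0) ?_
    intro p q a ha b hb
    simp [tensorD_tmk, A.d_d, B.d_d, A.d_eps]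
  leibniz := by
    intro n x hx y
    refine Submodule.span_induction (p := fun x _ => tensorD A B (x * y) =
        tensorD A B x * y + ((-1 : ℚ) ^ n) • (x * tensorD A B y)) ?_ (by simp)
      (fun x x' _ _ hx hx' => by
        simp only [add_mul, map_add, smul_add, hx, hx']; abel)
      (fun r x _ hx => by
        simp only [smul_mul_assoc, map_smul, hx, smul_add]
        rw [smul_comm]) hx
    rintro _ ⟨p, q, hpq, a, ha, b, hb, rfl⟩
    refine tensor_induction A B
      (f := tensorD A B ∘ₗ LinearMap.mul ℚ (TensorCarrier A B) (tmk A B a b))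
      (g := LinearMap.mul ℚ (TensorCarrier A B) (tensorD A B (tmk A B a b)) +
        ((-1 : ℚ) ^ n) • (LinearMap.mul ℚ (TensorCarrier A B) (tmk A B a b) ∘ₗ tensorD A B)) ?_ y
    intro p' q' a' ha' b' hb'
    simp only [LinearMap.comp_apply, LinearMap.mul_apply', LinearMap.add_apply,
      LinearMap.smul_apply, tensorD_tmk, A.eps_of_mem ha, A.eps_of_mem ha', map_smul,
      add_mul, mul_add, smul_mul_assoc, mul_smul_comm]
    rw [tmk_mul_tmk A B a hb ha' b', tmk_mul_tmk A B _ hb ha' b',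
      tmk_mul_tmk A B a (B.d_mem hb) ha' b', tmk_mul_tmk A B a hb (A.d_mem ha') b',
      tmk_mul_tmk A B a hb ha' (B.d b'), map_smul, tensorD_tmk, A.leibniz ha a', B.leibniz hb b',
      A.eps_of_mem (SetLike.GradedMul.mul_mem ha ha')]
    subst hpq
    simp only [map_add, map_smul, LinearMap.add_apply, LinearMap.smul_apply, smul_add, smul_smul,
      add_mul, mul_add, mul_one, one_mul, zpow_add₀ (show (-1 : ℚ) ≠ 0 by norm_num)]
    have e : (-1 : ℚ) ^ p * (-1) ^ q * ((-1) ^ (q * p') * (-1) ^ q) =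
        (-1) ^ (q * p') * (-1) ^ p := by
      linear_combination ((-1 : ℚ) ^ p * (-1) ^ (q * p')) * sgn_mul_self q
    rw [e]
    module

theorem CDGA.comm_units (A : CDGA.{u}) ⦃p q : ℤ⦄ (a : A.gr p) (b : A.gr q) :
    AlgHom.id ℚ A a * AlgHom.id ℚ A b =
      (-1 : ℤˣ) ^ (q * p) • (AlgHom.id ℚ A b * AlgHom.id ℚ A a) := by
  refine (A.comm a.2 b.2).trans ?_
  rw [mul_comm p q]
  exact (units_smul_eq _ _).symm

/-- The multiplication `μ : A ⊗ A → A`, a morphism of commutative cochain algebras. -/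
def CDGA.mu (A : CDGA.{u}) : CDGA.Hom (A.tensor A) A where
  toAlgHom := GradedTensorProduct.lift A.gr A.gr (AlgHom.id ℚ A) (AlgHom.id ℚ A) A.comm_units
  map_gr := by
    intro n x hx
    refine Submodule.span_induction (p := fun x _ => GradedTensorProduct.lift A.gr A.gr
      (AlgHom.id ℚ A) (AlgHom.id ℚ A) A.comm_units x ∈ A.gr n) ?_ (by rw [map_zero]; exact Submodule.zero_mem _)
      (fun x x' _ _ hx hx' => by rw [map_add]; exact Submodule.add_mem _ hx hx')
      (fun r x _ hx => by rw [map_smul]; exact Submodule.smul_mem _ _ hx) hx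
    rintro _ ⟨p, q, rfl, a, ha, b, hb, rfl⟩
    exact SetLike.GradedMul.mul_mem ha hb
  map_d := by
    intro x
    refine tensor_induction A A (f := (GradedTensorProduct.lift A.gr A.gr
      (AlgHom.id ℚ A) (AlgHom.id ℚ A) A.comm_units).toLinearMap ∘ₗ tensorD A A) (g := A.d ∘ₗ
      (GradedTensorProduct.lift A.gr A.gr (AlgHom.id ℚ A) (AlgHom.id ℚ A) A.comm_units).toLinearMap) ?_ x
    intro p q a ha b hb
    simp only [LinearMap.comp_apply, tensorD_tmk, map_add]
    exact (A.d_mul a b).symm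

end Tensor

/-! ### Polynomial differential forms on the standard simplices -/

/-- The generators `t_i` (degree `0`) and `dt_i` (degree `1`), `0 ≤ i ≤ n`. -/
inductive Gen (n : ℕ)
  | t (i : Fin (n + 1))
  | dt (i : Fin (n + 1))

/-- The degree of a generator. -/
def Gen.deg {n : ℕ} : Gen n → ℤ
  | .t _ => 0
  | .dt _ => 1

/-- The relations defining the polynomial forms on the `n`-simplex: graded commutativity,
`∑ t_i = 1` and `∑ dt_i = 0`. -/
inductive FormRel (n : ℕ) : FreeAlgebra ℚ (Gen n) → FreeAlgebra ℚ (Gen n) → Prop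
  | comm (x y : Gen n) : FormRel n (FreeAlgebra.ι ℚ x * FreeAlgebra.ι ℚ y)
      (((-1 : ℚ) ^ (x.deg * y.deg)) • (FreeAlgebra.ι ℚ y * FreeAlgebra.ι ℚ x))
  | sum_t : FormRel n (∑ i, FreeAlgebra.ι ℚ (Gen.t i)) 1
  | sum_dt : FormRel n (∑ i, FreeAlgebra.ι ℚ (Gen.dt i)) 0

/-- `(A_PL)_n = Λ(t_0, …, t_n, dt_0, …, dt_n) / (∑ t_i - 1, ∑ dt_i)`. -/
def Form (n : ℕ) : Type := RingQuot (FormRel n)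

namespace Form

instance (n : ℕ) : Ring (Form n) := inferInstanceAs (Ring (RingQuot (FormRel n)))
instance (n : ℕ) : Algebra ℚ (Form n) := inferInstanceAs (Algebra ℚ (RingQuot (FormRel n)))

variable {n : ℕ}

/-- The quotient map. -/
def mk : FreeAlgebra ℚ (Gen n) →ₐ[ℚ] Form n := RingQuot.mkAlgHom ℚ (FormRel n)

theorem mk_surjective : Function.Surjective (mk (n := n)) :=
  RingQuot.mkAlgHom_surjective ℚ (FormRel n)

theorem mk_rel {a b : FreeAlgebra ℚ (Gen n)} (h : FormRel n a b) : mk a = mk b :=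
  RingQuot.mkAlgHom_rel ℚ h

/-- The class of a generator. -/
def gen (x : Gen n) : Form n := mk (FreeAlgebra.ι ℚ x)

theorem gen_comm (x y : Gen n) :
    gen x * gen y = ((-1 : ℚ) ^ (x.deg * y.deg)) • (gen y * gen x) := by
  have h := mk_rel (FormRel.comm x y)
  rwa [map_mul, map_smul, map_mul] at h

theorem sum_t : ∑ i, gen (Gen.t i : Gen n) = 1 := by
  have h := mk_rel (FormRel.sum_t (n := n))
  rwa [map_sum, map_one] at h

theorem sum_dt : ∑ i, gen (Gen.dt i : Gen n) = 0 := by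
  have h := mk_rel (FormRel.sum_dt (n := n))
  rwa [map_sum, map_zero] at h

/-- The universal property of the algebra of polynomial forms. -/
def lift {B : Type u} [Ring B] [Algebra ℚ B] (f : Gen n → B)
    (hc : ∀ x y, f x * f y = ((-1 : ℚ) ^ (x.deg * y.deg)) • (f y * f x))
    (ht : ∑ i, f (Gen.t i) = 1) (hdt : ∑ i, f (Gen.dt i) = 0) : Form n →ₐ[ℚ] B :=
  RingQuot.liftAlgHom ℚ ⟨FreeAlgebra.lift ℚ f, by
    rintro _ _ (⟨x, y⟩ | _ | _)
    · simpa using hc x y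
    · simpa using ht
    · simpa using hdt⟩

theorem lift_gen {B : Type u} [Ring B] [Algebra ℚ B] (f : Gen n → B) (hc ht hdt) (x : Gen n) :
    lift f hc ht hdt (gen x) = f x := by
  refine (RingQuot.liftAlgHom_mkAlgHom_apply ℚ _ _ _).trans ?_
  simp

/-- The class of a word in the generators. -/
def word (l : List (Gen n)) : Form n := (l.map gen).prod

/-- The degree of a word. -/
def wdeg (l : List (Gen n)) : ℤ := (l.map Gen.deg).sum

/-- The forms of degree `p`: the span of the words in the `t_i`, `dt_i` of degree `p`. -/
def gr (n : ℕ) (p : ℤ) : Submodule ℚ (Form n) :=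
  Submodule.span ℚ {x | ∃ l : List (Gen n), wdeg l = p ∧ x = word l}

theorem word_nil : word ([] : List (Gen n)) = 1 := rfl

theorem word_cons (x : Gen n) (l : List (Gen n)) : word (x :: l) = gen x * word l := by
  simp [word]

theorem word_append (l l' : List (Gen n)) : word (l ++ l') = word l * word l' := by
  simp [word]

theorem wdeg_cons (x : Gen n) (l : List (Gen n)) : wdeg (x :: l) = x.deg + wdeg l := by
  simp [wdeg]

theorem wdeg_append (l l' : List (Gen n)) : wdeg (l ++ l') = wdeg l + wdeg l' := by
  simp [wdeg]

theorem word_mem (l : List (Gen n)) : word l ∈ gr n (wdeg l) :=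
  Submodule.subset_span ⟨l, rfl, rfl⟩

theorem gen_mem (x : Gen n) : gen x ∈ gr n x.deg := by
  simpa [word, wdeg] using word_mem [x]

theorem one_mem : (1 : Form n) ∈ gr n 0 := word_mem []

theorem gr_induction {p : ℤ} {P : Form n → Prop} {x : Form n} (hx : x ∈ gr n p)
    (hw : ∀ l, wdeg l = p → P (word l)) (h0 : P 0) (ha : ∀ x y, P x → P y → P (x + y))
    (hs : ∀ (r : ℚ) x, P x → P (r • x)) : P x := by
  refine Submodule.span_induction (p := fun x _ => P x) ?_ h0 (fun x y _ _ => ha x y)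
    (fun r x _ => hs r x) hx
  rintro _ ⟨l, hl, rfl⟩
  exact hw l hl

theorem mul_mem {p q : ℤ} {a b : Form n} (ha : a ∈ gr n p) (hb : b ∈ gr n q) :
    a * b ∈ gr n (p + q) := by
  refine gr_induction ha (P := fun a => a * b ∈ gr n (p + q)) ?_
    (by rw [zero_mul]; exact Submodule.zero_mem _)
    (fun x y hx hy => by rw [add_mul]; exact Submodule.add_mem _ hx hy)
    (fun r x hx => by rw [smul_mul_assoc]; exact Submodule.smul_mem _ _ hx)
  rintro l rfl
  refine gr_induction hb (P := fun b => word l * b ∈ gr n (wdeg l + q)) ?_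
    (by rw [mul_zero]; exact Submodule.zero_mem _)
    (fun x y hx hy => by rw [mul_add]; exact Submodule.add_mem _ hx hy)
    (fun r x hx => by rw [mul_smul_comm]; exact Submodule.smul_mem _ _ hx)
  rintro l' rfl
  rw [← word_append, ← wdeg_append]
  exact word_mem _

/-- The words span. -/
theorem span_words : Submodule.span ℚ (Set.range (word (n := n))) = ⊤ := by
  rw [eq_top_iff]
  rintro x -
  obtain ⟨y, rfl⟩ := mk_surjective x
  induction y using FreeAlgebra.induction with
  | grade0 r =>
    rw [AlgHom.commutes, Algebra.algebraMap_eq_smul_one]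
    exact Submodule.smul_mem _ _ (Submodule.subset_span ⟨[], rfl⟩)
  | grade1 x => exact Submodule.subset_span ⟨[x], by simp [word, gen]⟩
  | add a b ha hb => rw [map_add]; exact Submodule.add_mem _ ha hb
  | mul a b ha hb =>
    rw [map_mul]
    refine Submodule.span_induction (p := fun a _ => a * mk b ∈ _) ?_ ?_ ?_ ?_ ha
    · rintro _ ⟨l, rfl⟩
      refine Submodule.span_induction (p := fun b _ => word l * b ∈ _) ?_ ?_ ?_ ?_ hb
      · rintro _ ⟨l', rfl⟩
        exact Submodule.subset_span ⟨l ++ l', word_append l l'⟩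
      · rw [mul_zero]; exact Submodule.zero_mem _
      · intro x y _ _ hx hy; rw [mul_add]; exact Submodule.add_mem _ hx hy
      · intro r x _ hx; rw [mul_smul_comm]; exact Submodule.smul_mem _ _ hx
    · rw [zero_mul]; exact Submodule.zero_mem _
    · intro x y _ _ hx hy; rw [add_mul]; exact Submodule.add_mem _ hx hy
    · intro r x _ hx; rw [smul_mul_assoc]; exact Submodule.smul_mem _ _ hx

theorem word_induction {M : Type u} [AddCommGroup M] [Module ℚ M] {f g : Form n →ₗ[ℚ] M}
    (h : ∀ l, f (word l) = g (word l)) (x : Form n) : f x = g x := by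
  have : (⊤ : Submodule ℚ (Form n)) ≤ LinearMap.eqLocus f g := by
    rw [← span_words, Submodule.span_le]
    rintro _ ⟨l, rfl⟩
    exact h l
  exact this (Submodule.mem_top : x ∈ ⊤)

theorem iSup_gr : ⨆ p, gr n p = ⊤ := by
  rw [eq_top_iff, ← span_words, Submodule.span_le]
  rintro _ ⟨l, rfl⟩
  exact Submodule.mem_iSup_of_mem _ (word_mem l)

/-- The coaction `x ↦ x T^|x|` that detects the degree. -/
def coact : Form n →ₐ[ℚ] AddMonoidAlgebra (Form n) ℤ :=
  lift (fun x => AddMonoidAlgebra.single x.deg (gen x))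
    (fun x y => by
      rw [AddMonoidAlgebra.single_mul_single, AddMonoidAlgebra.single_mul_single, gen_comm,
        AddMonoidAlgebra.smul_single, add_comm])
    (by
      change ∑ i, AddMonoidAlgebra.single (0 : ℤ) (gen (Gen.t i)) = 1
      have h := map_sum (AddMonoidAlgebra.singleAddHom (R := Form n) (0 : ℤ))
        (fun i => gen (Gen.t i)) Finset.univ
      rw [sum_t] at h
      exact h.symm)
    (by
      change ∑ i, AddMonoidAlgebra.single (1 : ℤ) (gen (Gen.dt i)) = 0
      have h := map_sum (AddMonoidAlgebra.singleAddHom (R := Form n) (1 : ℤ))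
        (fun i => gen (Gen.dt i)) Finset.univ
      rw [sum_dt, map_zero] at h
      exact h.symm)

theorem coact_word (l : List (Gen n)) :
    coact (word l) = AddMonoidAlgebra.single (wdeg l) (word l) := by
  induction l with
  | nil => rw [word_nil, map_one]; rfl
  | cons x l ih =>
    rw [word_cons, map_mul, ih, coact, lift_gen, AddMonoidAlgebra.single_mul_single, wdeg_cons]

theorem internal : DirectSum.IsInternal (gr n) := by
  have hl : ∀ (p : ℤ), ∀ x ∈ gr n p, coact x = AddMonoidAlgebra.single p x := by
    intro p x hx
    refine gr_induction hx (P := fun x => coact x = AddMonoidAlgebra.single p x) ?_ (by simp)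
      (fun x y hx hy => by rw [map_add, hx, hy, AddMonoidAlgebra.single_add])
      (fun r x hx => by rw [map_smul, hx, AddMonoidAlgebra.smul_single])
    rintro l rfl
    exact coact_word l
  refine isInternal_of_proj _ (fun p =>
    { toFun := fun x => (coact x).coeff p
      map_add' := fun x y => by simp
      map_smul' := fun r x => by simp }) ?_ ?_ iSup_gr
  · intro p x hx
    change (coact x).coeff p = x
    rw [hl p x hx, AddMonoidAlgebra.coeff_single, Finsupp.single_eq_same]
  · intro p q hpq x hx
    change (coact x).coeff p = 0
    rw [hl q x hx, AddMonoidAlgebra.coeff_single, Finsupp.single_eq_of_ne hpq.symm]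

instance : GradedAlgebra (gr n) where
  one_mem := one_mem
  mul_mem := fun _ _ _ _ ha hb => mul_mem ha hb
  toDecomposition := internal.chooseDecomposition

theorem gen_word_comm (x : Gen n) (l : List (Gen n)) :
    gen x * word l = ((-1 : ℚ) ^ (x.deg * wdeg l)) • (word l * gen x) := by
  induction l with
  | nil => simp [word, wdeg]
  | cons y l ih =>
    rw [word_cons, wdeg_cons, ← mul_assoc, gen_comm, smul_mul_assoc, mul_assoc, ih, mul_smul_comm,
      smul_smul, mul_add, zpow_add₀ (by norm_num), mul_assoc]

theorem word_comm (l l' : List (Gen n)) :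
    word l * word l' = ((-1 : ℚ) ^ (wdeg l * wdeg l')) • (word l' * word l) := by
  induction l with
  | nil => simp [word, wdeg]
  | cons y l ih =>
    rw [word_cons, wdeg_cons, mul_assoc, ih, mul_smul_comm, ← mul_assoc, gen_word_comm,
      smul_mul_assoc, smul_smul, add_mul, zpow_add₀ (by norm_num), mul_assoc, mul_comm]

theorem form_comm {p q : ℤ} {a b : Form n} (ha : a ∈ gr n p) (hb : b ∈ gr n q) :
    a * b = ((-1 : ℚ) ^ (p * q)) • (b * a) := by
  refine gr_induction ha (P := fun a => a * b = ((-1 : ℚ) ^ (p * q)) • (b * a)) ?_ (by simp)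
    (fun x y hx hy => by rw [add_mul, mul_add, smul_add, hx, hy])
    (fun r x hx => by rw [smul_mul_assoc, mul_smul_comm, hx, smul_comm])
  rintro l rfl
  refine gr_induction hb (P := fun b => word l * b = ((-1 : ℚ) ^ (wdeg l * q)) • (b * word l)) ?_
    (by simp)
    (fun x y hx hy => by rw [add_mul, mul_add, smul_add, hx, hy])
    (fun r x hx => by rw [smul_mul_assoc, mul_smul_comm, hx, smul_comm])
  rintro l' rfl
  exact word_comm l l'

/-- The differential on generators: `t_i ↦ dt_i`, `dt_i ↦ 0`. -/
def dgen : Gen n → Form n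
  | .t i => gen (.dt i)
  | .dt _ => 0

/-- The representation `x ↦ ((-1)^|x| x, dx; 0, x)` that encodes the differential. -/
def rep : Form n →ₐ[ℚ] Matrix (Fin 2) (Fin 2) (Form n) :=
  lift (fun x => !![((-1 : ℚ) ^ x.deg) • gen x, dgen x; 0, gen x])
    (by
      have hc := gen_comm (n := n)
      rintro (i | i) (j | j)
      · have h1 := hc (.t i) (.t j)
        have h2 := hc (.t i) (.dt j)
        have h3 := hc (.dt i) (.t j)
        simp only [Gen.deg, mul_zero, zero_mul, zpow_zero, one_smul] at h1 h2 h3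
        simp only [Gen.deg, mul_zero, zpow_zero, one_smul, dgen, Matrix.mul_fin_two]
        simp [h1, h2, h3, add_comm]
      · have h1 := hc (.t i) (.dt j)
        have h2 := hc (.dt i) (.dt j)
        simp only [Gen.deg, mul_one, zpow_zero, one_smul, zpow_one, neg_smul] at h1 h2
        simp only [Gen.deg, mul_one, zpow_zero, one_smul, dgen, Matrix.mul_fin_two]
        simp [h1, h2]
      · have h1 := hc (.dt i) (.t j)
        have h2 := hc (.dt i) (.dt j)
        simp only [Gen.deg, mul_zero, mul_one, zpow_zero, one_smul, zpow_one, neg_smul] at h1 h2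
        simp only [Gen.deg, mul_zero, zpow_zero, one_smul, dgen, Matrix.mul_fin_two]
        simp [h1, h2]
      · have h2 := hc (.dt i) (.dt j)
        simp only [Gen.deg, mul_one, one_smul, zpow_one, neg_smul] at h2
        simp only [Gen.deg, mul_one, zpow_one, dgen, Matrix.mul_fin_two]
        simp [h2])
    (by
      have h1 := sum_t (n := n)
      have h2 := sum_dt (n := n)
      ext i j
      fin_cases i <;> fin_cases j <;> simp [Matrix.sum_apply, Gen.deg, dgen, h1, h2])
    (by
      have h2 := sum_dt (n := n)
      ext i j
      fin_cases i <;> fin_cases j <;> simp [Matrix.sum_apply, Gen.deg, dgen, h2])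

/-- The exterior derivative, the derivation with `t_i ↦ dt_i` and `dt_i ↦ 0`. -/
def d (n : ℕ) : Form n →ₗ[ℚ] Form n :=
  Matrix.entryLinearMap ℚ (Form n) (0 : Fin 2) (1 : Fin 2) ∘ₗ rep.toLinearMap

theorem rep_word (l : List (Gen n)) :
    rep (word l) = !![((-1 : ℚ) ^ wdeg l) • word l, d n (word l); 0, word l] := by
  have h : rep (word l) 0 0 = ((-1 : ℚ) ^ wdeg l) • word l ∧ rep (word l) 1 0 = 0 ∧
      rep (word l) 1 1 = word l := by
    induction l with
    | nil => simp [word, wdeg]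
    | cons x l ih =>
      obtain ⟨h0, h1, h2⟩ := ih
      rw [word_cons, map_mul, rep, lift_gen, ← rep]
      simp [Matrix.mul_apply, Fin.sum_univ_two, h0, h1, h2, wdeg_cons, smul_smul,
        zpow_add₀ (show (-1 : ℚ) ≠ 0 by norm_num), mul_comm]
  ext i j
  fin_cases i <;> fin_cases j
  · exact h.1
  · rfl
  · exact h.2.1
  · exact h.2.2

theorem d_gen (x : Gen n) : d n (gen x) = dgen x := by
  change rep (gen x) 0 1 = _
  rw [rep, lift_gen]
  rfl

theorem d_word_mul (l l' : List (Gen n)) : d n (word l * word l') =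
    d n (word l) * word l' + ((-1 : ℚ) ^ wdeg l) • (word l * d n (word l')) := by
  change rep (word l * word l') 0 1 = _
  rw [map_mul, rep_word, rep_word]
  simp [Matrix.mul_apply, Fin.sum_univ_two, add_comm]

theorem leibniz {p : ℤ} {a : Form n} (ha : a ∈ gr n p) (b : Form n) :
    d n (a * b) = d n a * b + ((-1 : ℚ) ^ p) • (a * d n b) := by
  refine gr_induction ha
    (P := fun a => d n (a * b) = d n a * b + ((-1 : ℚ) ^ p) • (a * d n b)) ?_ (by simp)
    (fun x y hx hy => by simp only [add_mul, map_add, smul_add, hx, hy]; abel)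
    (fun r x hx => by
      simp only [smul_mul_assoc, map_smul, hx, smul_add]
      rw [smul_comm])
  rintro l rfl
  refine word_induction (f := d n ∘ₗ LinearMap.mul ℚ (Form n) (word l))
    (g := LinearMap.mul ℚ (Form n) (d n (word l)) +
      ((-1 : ℚ) ^ wdeg l) • (LinearMap.mul ℚ (Form n) (word l) ∘ₗ d n)) ?_ b
  intro l'
  simpa using d_word_mul l l'

theorem d_gen_mem (x : Gen n) : d n (gen x) ∈ gr n (x.deg + 1) := by
  rw [d_gen]
  rcases x with i | i
  · exact gen_mem (.dt i)
  · exact Submodule.zero_mem _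

theorem d_one : d n 1 = 0 := by
  have h := leibniz (one_mem (n := n)) 1
  simpa using h

theorem d_word_mem (l : List (Gen n)) : d n (word l) ∈ gr n (wdeg l + 1) := by
  induction l with
  | nil => rw [word_nil, d_one]; exact Submodule.zero_mem _
  | cons x l ih =>
    rw [word_cons, leibniz (gen_mem x), wdeg_cons]
    refine Submodule.add_mem _ ?_ (Submodule.smul_mem _ _ ?_)
    · rw [add_right_comm]; exact mul_mem (d_gen_mem x) (word_mem l)
    · rw [add_assoc]; exact mul_mem (gen_mem x) ih

theorem d_mem {p : ℤ} {a : Form n} (ha : a ∈ gr n p) : d n a ∈ gr n (p + 1) := by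
  refine gr_induction ha (P := fun a => d n a ∈ gr n (p + 1)) ?_
    (by rw [map_zero]; exact Submodule.zero_mem _)
    (fun x y hx hy => by rw [map_add]; exact Submodule.add_mem _ hx hy)
    (fun r x hx => by rw [map_smul]; exact Submodule.smul_mem _ _ hx)
  rintro l rfl
  exact d_word_mem l

theorem d_d (a : Form n) : d n (d n a) = 0 := by
  refine word_induction (f := d n ∘ₗ d n) (g := 0) ?_ a
  intro l
  simp only [LinearMap.comp_apply, LinearMap.zero_apply]
  induction l with
  | nil => rw [word_nil, d_one, map_zero]
  | cons x l ih =>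
    have hx : d n (d n (gen x)) = 0 := by
      rcases x with i | i
      · rw [d_gen]; exact d_gen _
      · rw [d_gen]; exact map_zero _
    rw [word_cons, leibniz (gen_mem x), map_add, map_smul, leibniz (gen_mem x),
      leibniz (d_gen_mem x), hx, ih, zpow_add₀ (by norm_num)]
    simp

theorem gr_neg (p : ℤ) (hp : p < 0) : gr n p = ⊥ := by
  rw [gr, Submodule.span_eq_bot]
  rintro _ ⟨l, rfl, rfl⟩
  have h : 0 ≤ wdeg l := List.sum_nonneg (by
    intro x hx
    obtain ⟨y, -, rfl⟩ := List.mem_map.1 hx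
    rcases y with i | i
    · exact le_refl _
    · exact zero_le_one)
  omega

/-- The image of a generator under the map induced by `θ : {0, …, m} → {0, …, n}`:
`t_i ↦ ∑_{θ j = i} t_j`, `dt_i ↦ ∑_{θ j = i} dt_j`. -/
def pullGen {m : ℕ} (θ : Fin (m + 1) → Fin (n + 1)) : Gen n → Form m
  | .t i => ∑ j with θ j = i, gen (.t j)
  | .dt i => ∑ j with θ j = i, gen (.dt j)

theorem pullGen_mem {m : ℕ} (θ : Fin (m + 1) → Fin (n + 1)) (x : Gen n) :
    pullGen θ x ∈ gr m x.deg := by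
  rcases x with i | i
  · exact Submodule.sum_mem _ fun j _ => gen_mem (.t j)
  · exact Submodule.sum_mem _ fun j _ => gen_mem (.dt j)

/-- The pullback of polynomial forms along the affine map of simplices given on vertices by `θ`. -/
def pull {m : ℕ} (θ : Fin (m + 1) → Fin (n + 1)) : Form n →ₐ[ℚ] Form m :=
  lift (pullGen θ) (fun x y => form_comm (pullGen_mem θ x) (pullGen_mem θ y))
    (by
      rw [← sum_t]
      exact Finset.sum_fiberwise Finset.univ θ fun j => gen (Gen.t j))
    (by
      rw [← sum_dt (n := m)]
      exact Finset.sum_fiberwise Finset.univ θ fun j => gen (Gen.dt j))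

theorem pull_word_mem {m : ℕ} (θ : Fin (m + 1) → Fin (n + 1)) (l : List (Gen n)) :
    pull θ (word l) ∈ gr m (wdeg l) := by
  induction l with
  | nil => rw [word_nil, map_one]; exact one_mem
  | cons x l ih =>
    rw [word_cons, map_mul, wdeg_cons]
    refine mul_mem ?_ ih
    rw [pull, lift_gen]
    exact pullGen_mem θ x

theorem pull_d {m : ℕ} (θ : Fin (m + 1) → Fin (n + 1)) (a : Form n) :
    pull θ (d n a) = d m (pull θ a) := by
  refine word_induction (f := (pull θ).toLinearMap ∘ₗ d n) (g := d m ∘ₗ (pull θ).toLinearMap) ?_ a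
  intro l
  simp only [LinearMap.comp_apply, AlgHom.toLinearMap_apply]
  induction l with
  | nil => rw [word_nil, d_one, map_zero, map_one, d_one]
  | cons x l ih =>
    have hx : pull θ (d n (gen x)) = d m (pull θ (gen x)) := by
      rw [d_gen]
      conv_rhs => rw [pull, lift_gen]
      rcases x with i | i
      · simp [dgen, pull, lift_gen, pullGen, d_gen]
      · simp [dgen, pullGen, d_gen]
    have hm : pull θ (gen x) ∈ gr m x.deg := by
      rw [pull, lift_gen]; exact pullGen_mem θ x
    rw [word_cons, leibniz (gen_mem x), map_add, map_smul, map_mul, map_mul, map_mul,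
      leibniz hm, hx, ih]

end Form

/-! ### The cochain algebra `A_PL(X)` -/

theorem lof_internal (V : ℤ → Type u) [∀ p, AddCommGroup (V p)] [∀ p, Module ℚ (V p)] :
    DirectSum.IsInternal fun p => LinearMap.range (DirectSum.lof ℚ ℤ V p) := by
  refine isInternal_of_proj _ (fun p => DirectSum.lof ℚ ℤ V p ∘ₗ DirectSum.component ℚ ℤ V p)
    ?_ ?_ ?_
  · rintro p _ ⟨f, rfl⟩
    exact congrArg (DirectSum.lof ℚ ℤ V p) (DirectSum.component.lof_self ℚ p f)
  · rintro p q hpq _ ⟨f, rfl⟩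
    rw [LinearMap.comp_apply, DirectSum.component.of, dif_neg hpq, map_zero]
  · rw [eq_top_iff]
    rintro x -
    induction x using DirectSum.induction_on with
    | zero => exact Submodule.zero_mem _
    | of p f => exact Submodule.mem_iSup_of_mem p ⟨f, rfl⟩
    | add x y hx hy => exact Submodule.add_mem _ hx hy

section APL

open CategoryTheory Opposite

variable (K : SSet.{u})

/-- Families assigning to each simplex of `K` a polynomial form on the corresponding standard
simplex. -/
abbrev FormFamily : Type u := ∀ n : SimplexCategory, K.obj (op n) → Form n.len

/-- `A_PL^p(K)`: the families of polynomial `p`-forms, indexed by the simplices of `K`, that are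
compatible with the face and degeneracy operators. -/
def aplGr (p : ℤ) : Submodule ℚ (FormFamily K) where
  carrier := {f | (∀ n σ, f n σ ∈ Form.gr n.len p) ∧
    ∀ (m n : SimplexCategory) (θ : m ⟶ n) (σ : K.obj (op n)),
      f m (K.map θ.op σ) = Form.pull θ.toOrderHom (f n σ)}
  add_mem' := fun {f g} hf hg => ⟨fun n σ => Submodule.add_mem _ (hf.1 n σ) (hg.1 n σ),
    fun m n θ σ => by
      simp only [Pi.add_apply, map_add, hf.2 m n θ σ, hg.2 m n θ σ]⟩
  zero_mem' := ⟨fun _ _ => Submodule.zero_mem _, fun m n θ σ => by simp⟩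
  smul_mem' := fun r f hf => ⟨fun n σ => Submodule.smul_mem _ _ (hf.1 n σ),
    fun m n θ σ => by simp only [Pi.smul_apply, map_smul, hf.2 m n θ σ]⟩

instance : SetLike.GradedMonoid (aplGr K) where
  one_mem := ⟨fun _ _ => Form.one_mem, fun m n θ σ => by simp⟩
  mul_mem := fun p q f g hf hg => ⟨fun n σ => Form.mul_mem (hf.1 n σ) (hg.1 n σ),
    fun m n θ σ => by simp only [Pi.mul_apply, map_mul, hf.2 m n θ σ, hg.2 m n θ σ]⟩

/-- The simplexwise differential. -/
def aplD (p : ℤ) : aplGr K p →ₗ[ℚ] aplGr K (p + 1) where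
  toFun f := ⟨fun n σ => Form.d n.len (f.1 n σ), fun n σ => Form.d_mem (f.2.1 n σ),
    fun m n θ σ => by
      change Form.d m.len (f.1 m (K.map θ.op σ)) = Form.pull θ.toOrderHom (Form.d n.len (f.1 n σ))
      rw [f.2.2 m n θ σ, Form.pull_d]⟩
  map_add' f g := Subtype.ext (by funext n σ; exact map_add _ _ _)
  map_smul' r f := Subtype.ext (by funext n σ; exact (Form.d n.len).map_smul r (f.1 n σ))

/-- The underlying algebra `⨁ₚ A_PL^p(K)`. -/
abbrev AplCarrier : Type u := ⨁ p : ℤ, aplGr K p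

/-- The inclusion of the forms of degree `p`. -/
abbrev aplOf (p : ℤ) : aplGr K p →ₗ[ℚ] AplCarrier K := DirectSum.lof ℚ ℤ (fun p => aplGr K p) p

theorem aplOf_mul {p q : ℤ} (f : aplGr K p) (g : aplGr K q) :
    aplOf K p f * aplOf K q g =
      aplOf K (p + q) ⟨f.1 * g.1, SetLike.GradedMul.mul_mem f.2 g.2⟩ := by
  rw [DirectSum.lof_eq_of, DirectSum.lof_eq_of, DirectSum.lof_eq_of]
  exact DirectSum.of_mul_of (A := fun p => aplGr K p) f g

theorem aplOf_eq {p q : ℤ} (h : p = q) (f : aplGr K p) (g : aplGr K q) (hfg : f.1 = g.1) :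
    aplOf K p f = aplOf K q g := by
  subst h
  rw [Subtype.ext hfg]

theorem apl_internal : DirectSum.IsInternal fun p => LinearMap.range (aplOf K p) :=
  lof_internal fun p => aplGr K p

instance : GradedAlgebra fun p => LinearMap.range (aplOf K p) where
  one_mem := ⟨⟨1, SetLike.GradedOne.one_mem⟩, rfl⟩
  mul_mem := by
    rintro p q _ _ ⟨f, rfl⟩ ⟨g, rfl⟩
    rw [aplOf_mul]
    exact ⟨_, rfl⟩
  toDecomposition := (apl_internal K).chooseDecomposition

/-- The differential of `A_PL(K)`. -/
def aplTotalD : AplCarrier K →ₗ[ℚ] AplCarrier K :=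
  DirectSum.toModule ℚ ℤ _ fun p => aplOf K (p + 1) ∘ₗ aplD K p

theorem aplTotalD_of {p : ℤ} (f : aplGr K p) :
    aplTotalD K (aplOf K p f) = aplOf K (p + 1) (aplD K p f) := by
  simp [aplTotalD]

/-- The commutative cochain algebra `A_PL(K)` of polynomial forms on a simplicial set. -/
def aplSSet : CDGA.{u} where
  carrier := AplCarrier K
  gr p := LinearMap.range (aplOf K p)
  comm := by
    rintro p q _ _ ⟨f, rfl⟩ ⟨g, rfl⟩
    rw [aplOf_mul, aplOf_mul, ← map_smul]
    refine aplOf_eq K (add_comm p q) _ _ ?_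
    funext n σ
    exact Form.form_comm (f.2.1 n σ) (g.2.1 n σ)
  gr_neg := by
    intro p hp
    rw [LinearMap.range_eq_bot]
    ext1 f
    have : f = 0 := by
      apply Subtype.ext
      funext n σ
      have h := f.2.1 n σ
      rwa [Form.gr_neg p hp, Submodule.mem_bot] at h
    rw [this, map_zero, map_zero]
  d := aplTotalD K
  d_mem := by
    rintro p _ ⟨f, rfl⟩
    rw [aplTotalD_of]
    exact ⟨_, rfl⟩
  d_d := by
    intro x
    induction x using DirectSum.induction_on with
    | zero => simp
    | of p f =>
      change aplTotalD K (aplTotalD K (aplOf K p f)) = 0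
      rw [aplTotalD_of, aplTotalD_of]
      have : aplD K (p + 1) (aplD K p f) = 0 :=
        Subtype.ext (by funext n σ; exact Form.d_d _)
      rw [this, map_zero]
    | add x y hx hy => rw [map_add, map_add, hx, hy, add_zero]
  leibniz := by
    rintro p _ ⟨f, rfl⟩ b
    induction b using DirectSum.induction_on with
    | zero => simp
    | of q g =>
      change aplTotalD K (aplOf K p f * aplOf K q g) = aplTotalD K (aplOf K p f) * aplOf K q g +
        ((-1 : ℚ) ^ p) • (aplOf K p f * aplTotalD K (aplOf K q g))
      rw [aplOf_mul, aplTotalD_of, aplTotalD_of, aplTotalD_of, aplOf_mul, aplOf_mul,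
        aplOf_eq K (show p + (q + 1) = p + q + 1 by omega) _
          ⟨f.1 * (aplD K q g).1, by
            rw [show p + q + 1 = p + (q + 1) by omega]
            exact SetLike.GradedMul.mul_mem f.2 (aplD K q g).2⟩ rfl,
        aplOf_eq K (show p + 1 + q = p + q + 1 by omega) _
          ⟨(aplD K p f).1 * g.1, by
            rw [show p + q + 1 = p + 1 + q by omega]
            exact SetLike.GradedMul.mul_mem (aplD K p f).2 g.2⟩ rfl,
        ← map_smul, ← map_add]
      congr 1
      apply Subtype.ext
      funext n σ
      exact Form.leibniz (f.2.1 n σ) _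
    | add x y hx hy => simp only [mul_add, map_add, smul_add, hx, hy]; abel

/-- Sullivan's cochain algebra `A_PL(X)` of polynomial forms on the singular simplices of `X`. -/
def apl (X : Type u) [TopologicalSpace X] : CDGA.{u} := aplSSet (TopCat.toSSet.obj (TopCat.of X))

/-- The rational cohomology algebra `H^*(X) = H(A_PL(X))` of a space. -/
def rationalCohomology (X : Type u) [TopologicalSpace X] : CGA.{u} := (apl X).cohomology

end APL

/-! ### Sullivan models -/

/-- Graded commutativity `v w = (-1)^(|v||w|) w v` in the tensor algebra of a graded vector
space. -/
inductive LambdaRel (V : ℤ → Type u) [∀ p, AddCommGroup (V p)] [∀ p, Module ℚ (V p)] :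
    TensorAlgebra ℚ (⨁ p, V p) → TensorAlgebra ℚ (⨁ p, V p) → Prop
  | comm {p q : ℤ} (v : V p) (w : V q) : LambdaRel V
      (TensorAlgebra.ι ℚ (DirectSum.lof ℚ ℤ V p v) * TensorAlgebra.ι ℚ (DirectSum.lof ℚ ℤ V q w))
      (((-1 : ℚ) ^ (p * q)) • (TensorAlgebra.ι ℚ (DirectSum.lof ℚ ℤ V q w) *
        TensorAlgebra.ι ℚ (DirectSum.lof ℚ ℤ V p v)))

/-- The free commutative graded algebra `ΛV` on a graded vector space. -/
abbrev Lambda (V : ℤ → Type u) [∀ p, AddCommGroup (V p)] [∀ p, Module ℚ (V p)] : Type u :=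
  RingQuot (LambdaRel V)

/-- The canonical algebra map `ΛV → A` for a graded subspace `V` of a commutative graded
algebra `A`. -/
def lambdaMap (A : CGA.{u}) (V : ℤ → Submodule ℚ A) (hV : ∀ p, V p ≤ A.gr p) :
    Lambda (fun p => V p) →ₐ[ℚ] A :=
  RingQuot.liftAlgHom ℚ ⟨TensorAlgebra.lift ℚ (DirectSum.coeLinearMap V), by
    rintro _ _ ⟨v, w⟩
    simpa using A.comm (hV _ v.2) (hV _ w.2)⟩

/-- `(A, d)` is a Sullivan algebra: `A = ΛV` for a graded subspace `V` concentrated in degrees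
`≥ 1`, and `V` is the union of an increasing sequence of graded subspaces `V(0) ⊂ V(1) ⊂ ⋯` with
`d = 0` on `V(0)` and `d V(k + 1) ⊂ ΛV(k)`. -/
def CDGA.IsSullivanAlgebra (A : CDGA.{u}) : Prop :=
  ∃ (V : ℤ → Submodule ℚ A) (hV : ∀ p, V p ≤ A.gr p),
    (∀ p < 1, V p = ⊥) ∧ Function.Bijective (lambdaMap A.toCGA V hV) ∧
    ∃ F : ℕ → ℤ → Submodule ℚ A, (∀ p, Monotone fun k => F k p) ∧ (∀ p, ⨆ k, F k p = V p) ∧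
      (∀ p, ∀ v ∈ F 0 p, A.d v = 0) ∧
      (∀ k p, ∀ v ∈ F (k + 1) p, A.d v ∈ Algebra.adjoin ℚ (⋃ q, (F k q : Set A)))

/-- A Sullivan model of `X`: a Sullivan algebra `(ΛV, d)` with a quasi-isomorphism
`(ΛV, d) → A_PL(X)`. -/
structure SullivanModel (X : Type u) [TopologicalSpace X] where
  algebra : CDGA.{v}
  isSullivanAlgebra : algebra.IsSullivanAlgebra
  map : CDGA.Hom algebra (apl X)
  isQuasiIso : map.IsQuasiIso

/-- `X` has the homotopy type of a CW complex of finite type. -/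
def HasFiniteTypeCWHomotopyType (X : Type u) [TopologicalSpace X] : Prop :=
  ∃ (Y : Type u) (_ : TopologicalSpace Y) (_ : T2Space Y)
    (_ : Topology.CWComplex (Set.univ : Set Y)),
    Topology.RelCWComplex.FiniteType (Set.univ : Set Y) ∧
      Nonempty (ContinuousMap.HomotopyEquiv X Y)

/-! ### The invariants `mtc` and `htc` -/

/-- The projection `p_n : A ⊗ A → (A ⊗ A) / (ker μ)^(n+1)`, as a morphism of differential modules
over `A ⊗ A`. -/
def projTC (A : CDGA.{u}) (n : ℕ) :
    DGModule.Hom (A.tensor A).self ((A.tensor A).self.quotient (A.mu.ker.pow (n + 1)).toSub) :=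
  DGModule.quotientMap _ _

namespace SullivanModel

variable {X : Type u} [TopologicalSpace X] (S : SullivanModel.{u, v} X)

/-- `mtc(X)`: the least `n` such that `p_n` admits a homotopy retraction as a morphism of
`(ΛV ⊗ ΛV, d)`-modules (`∞` if there is none). -/
def mtc : ℕ∞ := ⨅ (n : ℕ) (_ : (projTC S.algebra n).HasHomotopyRetraction), (n : ℕ∞)

/-- `htc(X)`: the least `n` such that `H(p_n)` is injective (`∞` if there is none). -/
def htc : ℕ∞ := ⨅ (n : ℕ) (_ : Function.Injective (projTC S.algebra n).H), (n : ℕ∞)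

end SullivanModel

end RHT

end

noncomputable section

open scoped DirectSum TensorProduct

namespace RHT

/-! ### Cohomology criteria -/

/-! Write `A` for the Sullivan model and `B = A ⊗ A`. Both invariants are infima over `k` of a
condition on `p_k`, so it is enough that, for every `k`, `H(p_k)` is injective exactly when `p_k`
admits a homotopy retraction. One implication is formal: `H(ψ)` is an isomorphism and `ρ j = id`.
The other holds for every module morphism `f : B → N` out of `B`; nothing about the ideal `ker μ`
enters.

Poincaré duality provides a functional `e` on `A` that plays the role of the fundamental class: it
kills coboundaries, is concentrated in one degree `n`, and every functional on cohomology has the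
form `[z] ↦ e(z c)` for a cocycle `c` (`Hom.IsQuasiIso.exists_isDualizing`). By the Künneth theorem
and finite dimensionality, `e ⊗ e` has the same property on `B`, in degree `m = 2n`
(`IsDualizing.tensor`). Equivalently, `b ↦ (x ↦ e(x b))` identifies the cohomology of `B` with that
of a shifted dual `B^♯`.

Suppose now that `H(f)` is injective. Over a field the functional induced by `e` on `H(B)` extends
along `H(f)`, which gives a functional `ω` on `N` that kills coboundaries and satisfies `ω(f z) =
e(z)` for cocycles `z` (`exists_isCycleFunctional`). Then `n ↦ (x ↦ ω(x n))` is, up to signs and a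
shift, a module morphism `N → B^♯`, and its composite with `f` is a quasi-isomorphism by duality.
Thus `f` has a left inverse in the derived category.

To make it strict, let `P` be the homotopy pullback of `N → B^♯ ← B`. Its elements are triples `(n,
b, φ)`, where `φ` is a homotopy between the images of `n` and `f b` when the triple is a cocycle.
The projection `P → N` is a quasi-isomorphism because `B → B^♯` is one, `b ↦ (f b, b, 0)` lifts `f`,
and the projection to `B` retracts this lift (`Hom.hasHomotopyRetraction_of_injective`). -/

theorem Cohomology.map_injective_iff {M : Type u} [AddCommGroup M] [Module ℚ M] {N : Type v}
    [AddCommGroup N] [Module ℚ N] {d : M →ₗ[ℚ] M} {d' : N →ₗ[ℚ] N} (f : M →ₗ[ℚ] N)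
    (hf : ∀ x, f (d x) = d' (f x)) :
    Function.Injective (Cohomology.map f hf) ↔
      ∀ z, d z = 0 → ∀ y, d' y = f z → ∃ x, d x = z := by
  rw [injective_iff_map_eq_zero]
  constructor
  · intro h z hz y hy
    have hz' : f z ∈ LinearMap.ker d' := by rw [LinearMap.mem_ker, ← hf, hz, map_zero]
    refine (Cohomology.cls_eq_zero ⟨z, hz⟩).1 (h _ ?_)
    rw [Cohomology.map_cls f hf ⟨z, hz⟩ hz', Cohomology.cls_eq_zero]
    exact ⟨y, hy⟩
  · intro h c hc
    obtain ⟨⟨z, hz⟩, rfl⟩ := Cohomology.cls_surjective _ c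
    have hz' : f z ∈ LinearMap.ker d' := by
      rw [LinearMap.mem_ker, ← hf, show d z = 0 from hz, map_zero]
    rw [Cohomology.map_cls f hf ⟨z, hz⟩ hz', Cohomology.cls_eq_zero] at hc
    obtain ⟨y, hy⟩ := hc
    exact (Cohomology.cls_eq_zero _).2 (h z hz y hy)

theorem Cohomology.map_surjective_of {M : Type u} [AddCommGroup M] [Module ℚ M] {N : Type v}
    [AddCommGroup N] [Module ℚ N] {d : M →ₗ[ℚ] M} {d' : N →ₗ[ℚ] N} (f : M →ₗ[ℚ] N)
    (hf : ∀ x, f (d x) = d' (f x)) (h : ∀ y, d' y = 0 → ∃ z, d z = 0 ∧ f z = y) :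
    Function.Surjective (Cohomology.map f hf) := by
  intro c
  obtain ⟨⟨y, hy⟩, rfl⟩ := Cohomology.cls_surjective _ c
  obtain ⟨z, hz, rfl⟩ := h y hy
  exact ⟨Cohomology.cls d ⟨z, hz⟩, Cohomology.map_cls f hf ⟨z, hz⟩ hy⟩

/-- A functional that vanishes on `ker g` factors through `g`. -/
theorem exists_comp_eq {M : Type u} [AddCommGroup M] [Module ℚ M] {N : Type v}
    [AddCommGroup N] [Module ℚ N] (g : M →ₗ[ℚ] N) (ψ : M →ₗ[ℚ] ℚ)
    (h : ∀ x, g x = 0 → ψ x = 0) : ∃ χ : N →ₗ[ℚ] ℚ, ∀ x, χ (g x) = ψ x := by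
  -- Over a field the image of the transpose is the annihilator of the kernel, with no finiteness
  -- assumption.
  have h' : ψ ∈ LinearMap.range g.dualMap := by
    rw [LinearMap.range_dualMap_eq_dualAnnihilator_ker, Submodule.mem_dualAnnihilator]
    exact fun x hx => h x hx
  obtain ⟨χ, rfl⟩ := h'
  exact ⟨χ, fun x => rfl⟩

theorem isInternal_prod {M : Type u} [AddCommGroup M] [Module ℚ M] {N : Type v}
    [AddCommGroup N] [Module ℚ N] {G : ℤ → Submodule ℚ M} {G' : ℤ → Submodule ℚ N}
    (hG : DirectSum.IsInternal G) (hG' : DirectSum.IsInternal G') :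
    DirectSum.IsInternal fun p => (G p).prod (G' p) := by
  refine isInternal_of_proj.{max u v} _ (fun p => (proj hG p).prodMap (proj hG' p)) ?_ ?_ ?_
  · rintro p ⟨x, y⟩ ⟨hx, hy⟩
    exact Prod.ext (proj_of_mem hG hx) (proj_of_mem hG' hy)
  · rintro p q h ⟨x, y⟩ ⟨hx, hy⟩
    exact Prod.ext (proj_of_mem_ne hG h hx) (proj_of_mem_ne hG' h hy)
  · rw [eq_top_iff]
    rintro ⟨x, y⟩ -
    obtain ⟨s, hs⟩ := exists_sum_proj hG x
    obtain ⟨t, ht⟩ := exists_sum_proj hG' y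
    rw [show ((x, y) : M × N) = LinearMap.inl ℚ M N x + LinearMap.inr ℚ M N y by simp,
      ← hs, ← ht, map_sum, map_sum]
    refine Submodule.add_mem _ (Submodule.sum_mem _ fun p _ => ?_)
      (Submodule.sum_mem _ fun p _ => ?_)
    · exact Submodule.mem_iSup_of_mem p ⟨proj_mem hG p x, Submodule.zero_mem _⟩
    · exact Submodule.mem_iSup_of_mem p ⟨Submodule.zero_mem _, proj_mem hG' p y⟩

/-! ### Dualizing functionals. -/

namespace CDGA

variable (B : CDGA.{u})

theorem eps_one : B.eps 1 = 1 := by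
  rw [B.eps_of_mem (SetLike.GradedOne.one_mem : (1 : B) ∈ B.gr 0), zpow_zero, one_smul]

theorem eps_mem {p : ℤ} {a : B} (ha : a ∈ B.gr p) : B.eps a ∈ B.gr p := by
  rw [B.eps_of_mem ha]
  exact Submodule.smul_mem _ _ ha

/-- `e` is a functional of degree `m` that vanishes on the coboundaries and such that every
functional on cohomology is of the form `[z] ↦ e (z c)` for a cocycle `c`. -/
structure IsDualizing (m : ℤ) (e : B →ₗ[ℚ] ℚ) : Prop where
  map_d : ∀ x, e (B.d x) = 0
  map_of_mem_ne : ∀ q, q ≠ m → ∀ x ∈ B.gr q, e x = 0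
  exists_eq : ∀ ψ : B →ₗ[ℚ] ℚ, (∀ x, ψ (B.d x) = 0) →
    ∃ c, B.d c = 0 ∧ ∀ z, B.d z = 0 → ψ z = e (z * c)

variable {B}

/-- A functional killing the coboundaries that does not kill a cocycle which is not a
coboundary. -/
theorem exists_functional {M : Type u} [AddCommGroup M] [Module ℚ M] (d : M →ₗ[ℚ] M) (z : M)
    (hz : ∀ x, d x ≠ z) : ∃ ψ : M →ₗ[ℚ] ℚ, (∀ x, ψ (d x) = 0) ∧ ψ z ≠ 0 := by
  obtain ⟨ψ, h1, h2⟩ := Submodule.exists_le_ker_of_notMem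
    (p := LinearMap.range d) (v := z) (fun ⟨x, hx⟩ => hz x hx)
  exact ⟨ψ, fun x => h2 ⟨x, rfl⟩, h1⟩

theorem d_proj {z : B} (hz : B.d z = 0) (p : ℤ) : B.d (proj B.internal p z) = 0 := by
  rw [← proj_d, hz, map_zero]

namespace IsDualizing

variable {m : ℤ} {e : B →ₗ[ℚ] ℚ}

theorem map_proj (he : B.IsDualizing m e) (z : B) : e (proj B.internal m z) = e z := by
  refine homogeneous_induction B.internal (f := e ∘ₗ proj B.internal m) (g := e) ?_ z
  intro p x hx
  by_cases h : p = m
  · subst h; simp [proj_of_mem _ hx]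
  · simp [proj_of_mem_ne _ h hx, he.map_of_mem_ne p h x hx]

/-- Only the component of `b` in degree `m - q` contributes to either side, so graded commutativity
gives one and the same sign even for inhomogeneous `b`. -/
theorem map_mul_comm (he : B.IsDualizing m e) {q : ℤ} {c : B} (hc : c ∈ B.gr q) (b : B) :
    e (b * c) = (-1 : ℚ) ^ ((m - q) * q) * e (c * b) := by
  refine homogeneous_induction B.internal (f := e ∘ₗ (LinearMap.mul ℚ B).flip c)
    (g := (-1 : ℚ) ^ ((m - q) * q) • (e ∘ₗ LinearMap.mul ℚ B c)) ?_ b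
  intro p x hx
  by_cases h : p = m - q
  · subst h
    simp [B.comm hx hc]
  · have h1 := he.map_of_mem_ne (p + q) (by omega) _ (SetLike.GradedMul.mul_mem hx hc)
    have h2 := he.map_of_mem_ne (q + p) (by omega) _ (SetLike.GradedMul.mul_mem hc hx)
    simp [h1, h2]

/-- The pairing is nondegenerate on cohomology. -/
theorem exists_d_eq (he : B.IsDualizing m e) {b : B} (hb : B.d b = 0)
    (h : ∀ x, B.d x = 0 → e (x * b) = 0) : ∃ y, B.d y = b := by
  by_contra hcon
  obtain ⟨ψ, hψ, hne⟩ := exists_functional B.d b (fun x hx => hcon ⟨x, hx⟩)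
  obtain ⟨c, hc, hψc⟩ := he.exists_eq ψ hψ
  apply hne
  -- The representing cocycle `c` stands to the right of `b`, whereas the hypothesis concerns
  -- products with `b` on the right. The homogeneous components of `c` are again cocycles and move
  -- across `b` at the cost of a sign.
  obtain ⟨s, hs⟩ := exists_sum_proj B.internal c
  rw [hψc b hb, ← hs, Finset.mul_sum, map_sum]
  refine Finset.sum_eq_zero fun p _ => ?_
  rw [he.map_mul_comm (proj_mem B.internal p c), h _ (d_proj hc p), mul_zero]

end IsDualizing

/-! ### The bounded dual -/

variable (B)

/-- The functionals on `B` that vanish in all large degrees. -/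
def boundedDual : Submodule ℚ (B →ₗ[ℚ] ℚ) where
  carrier := {φ | ∃ k : ℤ, ∀ q, k < q → ∀ x ∈ B.gr q, φ x = 0}
  zero_mem' := ⟨0, fun _ _ _ _ => rfl⟩
  add_mem' := by
    rintro φ ψ ⟨k, hk⟩ ⟨l, hl⟩
    refine ⟨max k l, fun q hq x hx => ?_⟩
    rw [LinearMap.add_apply, hk q (lt_of_le_of_lt (le_max_left _ _) hq) x hx,
      hl q (lt_of_le_of_lt (le_max_right _ _) hq) x hx, add_zero]
  smul_mem' := by
    rintro r φ ⟨k, hk⟩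
    exact ⟨k, fun q hq x hx => by rw [LinearMap.smul_apply, hk q hq x hx, smul_zero]⟩

/-- The bounded dual of `B`, on which `B` acts by `(a φ)(x) = (-1)^|a| φ(x a)`. -/
def TwistedDual : Type u := B.boundedDual

namespace TwistedDual

instance : AddCommGroup B.TwistedDual := inferInstanceAs (AddCommGroup B.boundedDual)
instance : Module ℚ B.TwistedDual := inferInstanceAs (Module ℚ B.boundedDual)

variable {B}

/-- The underlying functional. -/
def eval : B.TwistedDual →ₗ[ℚ] B →ₗ[ℚ] ℚ := B.boundedDual.subtype

theorem ext {φ ψ : B.TwistedDual} (h : ∀ x, eval φ x = eval ψ x) : φ = ψ :=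
  Subtype.ext (LinearMap.ext h)

theorem bounded (φ : B.TwistedDual) : ∃ k : ℤ, ∀ q, k < q → ∀ x ∈ B.gr q, eval φ x = 0 := φ.2

/-- A bounded functional as an element of the dual. -/
def of (φ : B →ₗ[ℚ] ℚ) (h : ∃ k : ℤ, ∀ q, k < q → ∀ x ∈ B.gr q, φ x = 0) : B.TwistedDual :=
  ⟨φ, h⟩

@[simp] theorem eval_of (φ : B →ₗ[ℚ] ℚ) (h) : eval (of φ h) = φ := rfl

/-- Since `B` has no negative degrees, multiplication never lowers the degree; hence boundedness
survives the action of an arbitrary element of `B`. -/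
theorem vanish_mul {φ : B →ₗ[ℚ] ℚ} {k : ℤ} (h : ∀ q, k < q → ∀ x ∈ B.gr q, φ x = 0)
    {q : ℤ} (hq : k < q) {x : B} (hx : x ∈ B.gr q) (a : B) : φ (x * a) = 0 := by
  refine homogeneous_induction B.internal (f := φ ∘ₗ LinearMap.mul ℚ B x) (g := 0) ?_ a
  intro p y hy
  by_cases hy0 : y = 0
  · simp [hy0]
  · have := nonneg_of_ne_zero hy hy0
    exact h (q + p) (by omega) _ (SetLike.GradedMul.mul_mem hx hy)

/-- Acting by multiplication on the right of the argument makes this a left action without any use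
of commutativity. The involution inserts the sign that the degree shift calls for. -/
instance : SMul B B.TwistedDual where
  smul a φ := of (eval φ ∘ₗ (LinearMap.mul ℚ B).flip (B.eps a)) (by
    obtain ⟨k, hk⟩ := bounded φ
    exact ⟨k, fun q hq x hx => vanish_mul hk hq hx _⟩)

@[simp] theorem eval_smul (a : B) (φ : B.TwistedDual) (x : B) :
    eval (a • φ) x = eval φ (x * B.eps a) := rfl

instance : Module B B.TwistedDual where
  one_smul φ := ext fun x => by simp [eps_one]
  mul_smul a b φ := ext fun x => by simp [eps_mul, mul_assoc]
  smul_zero a := ext fun x => by simp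
  smul_add a φ ψ := ext fun x => by simp
  add_smul a b φ := ext fun x => by simp [mul_add]
  zero_smul φ := ext fun x => by simp

instance : IsScalarTower ℚ B B.TwistedDual :=
  ⟨fun r a φ => ext fun x => by simp⟩

/-- The component of degree `p` when the functionals on `B^m` are given the degree `1`. -/
def gr (m p : ℤ) : Submodule ℚ B.TwistedDual where
  carrier := {φ | ∀ q, q ≠ m + 1 - p → ∀ x ∈ B.gr q, eval φ x = 0}
  zero_mem' := fun _ _ _ _ => by simp
  add_mem' := fun {φ ψ} hφ hψ q hq x hx => by simp [hφ q hq x hx, hψ q hq x hx]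
  smul_mem' := fun r φ hφ q hq x hx => by simp [hφ q hq x hx]

/-- The restriction of a functional to the component of degree `q` of `B`. -/
def restr (q : ℤ) : B.TwistedDual →ₗ[ℚ] B.TwistedDual where
  toFun φ := of (eval φ ∘ₗ proj B.internal q) ⟨q, fun q' hq x hx => by
    rw [LinearMap.comp_apply, proj_of_mem_ne B.internal (by omega) hx, map_zero]⟩
  map_add' φ ψ := ext fun x => by simp
  map_smul' r φ := ext fun x => by simp

theorem eval_restr (q : ℤ) (φ : B.TwistedDual) (x : B) :
    eval (restr q φ) x = eval φ (proj B.internal q x) := rfl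

/-- This is where boundedness is needed: as `B` lives in degrees `≥ 0`, a bounded functional is
supported in the finitely many degrees `0, …, k` and is the sum of its restrictions to them. The
full dual is in general a product over the degrees rather than a direct sum. -/
theorem internal (m : ℤ) : DirectSum.IsInternal (gr (B := B) m) := by
  refine isInternal_of_proj _ (fun p => restr (m + 1 - p)) ?_ ?_ ?_
  · intro p φ hφ
    refine ext fun x => ?_
    rw [eval_restr]
    refine homogeneous_induction B.internal (f := eval φ ∘ₗ proj B.internal (m + 1 - p))
      (g := eval φ) ?_ x
    intro q y hy
    by_cases h : q = m + 1 - p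
    · subst h; simp [proj_of_mem _ hy]
    · simp [proj_of_mem_ne _ h hy, hφ q h y hy]
  · intro p q hpq φ hφ
    refine ext fun x => ?_
    rw [eval_restr, hφ (m + 1 - p) (by omega) _ (proj_mem _ _ _)]
    simp
  · rw [eq_top_iff]
    rintro φ -
    obtain ⟨k, hk⟩ := bounded φ
    have h : φ = ∑ q ∈ Finset.Icc 0 k, restr q φ := by
      refine ext fun x => ?_
      refine homogeneous_induction B.internal (f := eval φ)
        (g := eval (∑ q ∈ Finset.Icc 0 k, restr q φ)) ?_ x
      intro p y hy
      rw [map_sum, LinearMap.sum_apply]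
      simp only [eval_restr]
      by_cases hy0 : y = 0
      · simp [hy0]
      have hp := nonneg_of_ne_zero hy hy0
      by_cases hpk : p ≤ k
      · rw [Finset.sum_eq_single p]
        · rw [proj_of_mem _ hy]
        · intro q _ hq
          rw [proj_of_mem_ne _ hq.symm hy, map_zero]
        · intro h
          exact absurd (Finset.mem_Icc.2 ⟨hp, hpk⟩) h
      · rw [hk p (by omega) y hy]
        refine (Finset.sum_eq_zero fun q hq => ?_).symm
        rw [Finset.mem_Icc] at hq
        rw [proj_of_mem_ne _ (by omega) hy, map_zero]
    rw [h]
    refine Submodule.sum_mem _ fun q _ => Submodule.mem_iSup_of_mem (m + 1 - q) ?_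
    intro q' hq' x hx
    rw [eval_restr, proj_of_mem_ne _ (by omega) hx, map_zero]

/-- The differential `φ ↦ φ d ε`. -/
def diff : B.TwistedDual →ₗ[ℚ] B.TwistedDual where
  toFun φ := of (eval φ ∘ₗ B.d ∘ₗ B.eps) (by
    obtain ⟨k, hk⟩ := bounded φ
    exact ⟨k, fun q hq x hx => hk (q + 1) (by omega) _ (B.d_mem (B.eps_mem hx))⟩)
  map_add' φ ψ := ext fun x => by simp
  map_smul' r φ := ext fun x => by simp

theorem eval_diff (φ : B.TwistedDual) (x : B) :
    eval (diff φ) x = eval φ (B.d (B.eps x)) := rfl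

end TwistedDual

/-- The bounded dual of `B`, shifted so that the functionals on `B^m` have degree `1`. -/
def twistedDual (m : ℤ) : DGModule.{u, u} B where
  carrier := B.TwistedDual
  gr := TwistedDual.gr m
  internal := TwistedDual.internal m
  smul_mem := by
    intro p q a φ ha hφ r hr x hx
    rw [TwistedDual.eval_smul]
    exact hφ (r + p) (by omega) _ (SetLike.GradedMul.mul_mem hx (B.eps_mem ha))
  d := TwistedDual.diff
  d_mem := by
    intro p φ hφ r hr x hx
    rw [TwistedDual.eval_diff]
    exact hφ (r + 1) (by omega) _ (B.d_mem (B.eps_mem hx))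
  d_d := by
    intro φ
    refine TwistedDual.ext fun x => ?_
    simp [TwistedDual.eval_diff, d_eps, B.d_d]
  leibniz := by
    intro p a ha φ
    refine TwistedDual.ext fun x => ?_
    have h1 : B.eps (B.d a) = -((-1 : ℚ) ^ p • B.d a) := by
      rw [B.eps_of_mem (B.d_mem ha), zpow_add₀ (by norm_num), zpow_one, mul_neg_one, neg_smul]
    simp only [map_add, LinearMap.add_apply, map_smul, LinearMap.smul_apply,
      TwistedDual.eval_smul, TwistedDual.eval_diff, eps_mul, eps_eps, d_mul, h1, smul_add,
      B.eps_of_mem ha]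
    -- What remains is an identity between values of `φ` that uses only that the sign `(-1)^p` has
    -- square `1`.
    simp only [mul_smul_comm, mul_neg, map_neg, map_smul, smul_eq_mul]
    linear_combination (-(-1 : ℚ) ^ p * (TwistedDual.eval φ (B.d (B.eps x) * a) +
      TwistedDual.eval φ (x * B.d a))) * sgn_mul_self p

end CDGA

/-! ### Functionals on differential modules and twisted products. -/

namespace DGModule

variable {B : CDGA.{u}}

theorem d_smul (N : DGModule.{u, v} B) (a : B) (n : N) :
    N.d (a • n) = B.d a • n + B.eps a • N.d n := by
  refine homogeneous_induction B.internal
    (f := N.d ∘ₗ (LinearMap.toSpanSingleton B N n).restrictScalars ℚ)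
    (g := (LinearMap.toSpanSingleton B N n).restrictScalars ℚ ∘ₗ B.d +
      (LinearMap.toSpanSingleton B N (N.d n)).restrictScalars ℚ ∘ₗ B.eps) ?_ a
  intro p x hx
  simp [N.leibniz hx, B.eps_of_mem hx]

theorem proj_d (N : DGModule.{u, v} B) (p : ℤ) (n : N) :
    proj N.internal (p + 1) (N.d n) = N.d (proj N.internal p n) := by
  refine homogeneous_induction N.internal (f := proj N.internal (p + 1) ∘ₗ N.d)
    (g := N.d ∘ₗ proj N.internal p) ?_ n
  intro q x hx
  by_cases h : q = p
  · subst h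
    simp [proj_of_mem _ hx, proj_of_mem _ (N.d_mem hx)]
  · simp [proj_of_mem_ne _ h hx, proj_of_mem_ne _ (show q + 1 ≠ p + 1 by omega) (N.d_mem hx)]

theorem Hom.map_proj {M : DGModule.{u, v} B} {N : DGModule.{u, w} B} (f : Hom M N) (p : ℤ)
    (x : M) : f.toLinearMap (proj M.internal p x) = proj N.internal p (f.toLinearMap x) := by
  refine homogeneous_induction M.internal
    (f := f.toLinearMap.restrictScalars ℚ ∘ₗ proj M.internal p)
    (g := proj N.internal p ∘ₗ f.toLinearMap.restrictScalars ℚ) ?_ x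
  intro q y hy
  by_cases h : q = p
  · subst h
    simp [proj_of_mem _ hy, proj_of_mem _ (f.map_gr hy)]
  · simp [proj_of_mem_ne _ h hy, proj_of_mem_ne _ h (f.map_gr hy)]

/-- A morphism with a homotopy retraction is injective in cohomology. -/
theorem Hom.HasHomotopyRetraction.injective {M N : DGModule.{u, u} B} {f : Hom M N}
    (h : f.HasHomotopyRetraction) : Function.Injective f.H := by
  obtain ⟨P, j, ψ, ρ, hψ, hj, hρ⟩ := h
  refine (Cohomology.map_injective_iff _ _).2 fun z hz y hy => ?_
  have hd : P.d (j.toLinearMap z) = 0 := by rw [← j.map_d, hz, map_zero]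
  obtain ⟨x, hx⟩ := (Cohomology.map_injective_iff _ _).1 hψ.1 (j.toLinearMap z) hd y
    (hy.trans (hj z).symm)
  exact ⟨ρ.toLinearMap x, by rw [← ρ.map_d, hx, hρ]⟩

/-- A functional on `N` of degree `m` that vanishes on the coboundaries. -/
structure IsCycleFunctional (N : DGModule.{u, v} B) (m : ℤ) (ω : N →ₗ[ℚ] ℚ) : Prop where
  map_d : ∀ n, ω (N.d n) = 0
  map_of_mem_ne : ∀ q, q ≠ m → ∀ n ∈ N.gr q, ω n = 0

/-- If `H(f)` is injective, a dualizing functional on `B` extends along `f` up to its values on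
elements that are not cocycles. -/
theorem exists_isCycleFunctional {m : ℤ} {e : B →ₗ[ℚ] ℚ} (he : B.IsDualizing m e)
    {N : DGModule.{u, v} B} (f : Hom B.self N) (hf : Function.Injective f.H) :
    ∃ ω : N →ₗ[ℚ] ℚ, N.IsCycleFunctional m ω ∧
      ∀ z : B, B.d z = 0 → ω (f.toLinearMap z) = e z := by
  let g : LinearMap.ker B.d →ₗ[ℚ] N ⧸ LinearMap.range N.d :=
    (LinearMap.range N.d).mkQ ∘ₗ f.toLinearMap.restrictScalars ℚ ∘ₗ (LinearMap.ker B.d).subtype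
  -- Injectivity of `H(f)` says that a cocycle whose image under `f` is a coboundary is itself a
  -- coboundary, so `e` vanishes on the kernel of `g` and factors through it.
  obtain ⟨ω, hω⟩ := exists_comp_eq g (e ∘ₗ (LinearMap.ker B.d).subtype) (by
    rintro ⟨z, hz⟩ h
    obtain ⟨y, hy⟩ := (Submodule.Quotient.mk_eq_zero _).1 h
    obtain ⟨x, rfl⟩ := (Cohomology.map_injective_iff _ _).1 hf z hz y hy
    exact he.map_d x)
  -- The extension need not be concentrated in one degree. Composing with the projection to degree
  -- `m` forces this, and does not change the values on `f z` because `e` already lives in degree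
  -- `m`.
  refine ⟨ω ∘ₗ (LinearMap.range N.d).mkQ ∘ₗ proj N.internal m, ⟨fun n => ?_, ?_⟩, ?_⟩
  · have h : proj N.internal m (N.d n) = N.d (proj N.internal (m - 1) n) := by
      rw [← proj_d, sub_add_cancel]
    have h' : (LinearMap.range N.d).mkQ (N.d (proj N.internal (m - 1) n)) = 0 :=
      (Submodule.Quotient.mk_eq_zero _).2 ⟨_, rfl⟩
    rw [LinearMap.comp_apply, LinearMap.comp_apply, h, h', map_zero]
  · intro q hq n hn
    simp [proj_of_mem_ne _ hq hn]
  · intro z hz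
    refine Eq.trans ?_ ((hω ⟨proj B.internal m z, CDGA.d_proj hz m⟩).trans (he.map_proj z))
    exact congrArg (fun n => ω ((LinearMap.range N.d).mkQ n)) (f.map_proj m z).symm

/-- The product of two differential modules. -/
def prod (M : DGModule.{u, v} B) (N : DGModule.{u, w} B) : DGModule.{u, max v w} B where
  carrier := M × N
  gr p := (M.gr p).prod (N.gr p)
  internal := isInternal_prod M.internal N.internal
  smul_mem := fun ha hm => ⟨M.smul_mem ha hm.1, N.smul_mem ha hm.2⟩
  d := M.d.prodMap N.d
  d_mem := fun hm => ⟨M.d_mem hm.1, N.d_mem hm.2⟩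
  d_d := fun _ => Prod.ext (M.d_d _) (N.d_d _)
  leibniz := fun ha _ => Prod.ext (M.leibniz ha _) (N.leibniz ha _)

/-- The product `M × E` with the differential `d(x, y) = (dx, dy + g x)`, for a map `g : M → E` of
degree `1` that is linear and compatible with the differentials in the graded sense. -/
def twistedProd (M : DGModule.{u, v} B) (E : DGModule.{u, w} B) (g : M →ₗ[ℚ] E)
    (hg : ∀ {p : ℤ} {x : M}, x ∈ M.gr p → g x ∈ E.gr (p + 1))
    (hs : ∀ (a : B) (x : M), g (a • x) = B.eps a • g x) (hd : ∀ x, g (M.d x) = -E.d (g x)) :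
    DGModule.{u, max v w} B where
  carrier := M × E
  gr p := (M.gr p).prod (E.gr p)
  internal := isInternal_prod M.internal E.internal
  smul_mem := fun ha hm => ⟨M.smul_mem ha hm.1, E.smul_mem ha hm.2⟩
  d := (M.d ∘ₗ LinearMap.fst ℚ M E).prod (E.d ∘ₗ LinearMap.snd ℚ M E + g ∘ₗ LinearMap.fst ℚ M E)
  d_mem := fun hm => ⟨M.d_mem hm.1, Submodule.add_mem _ (E.d_mem hm.2) (hg hm.1)⟩
  d_d := fun y => by
    refine Prod.ext (M.d_d _) ?_
    change E.d (E.d y.2 + g y.1) + g (M.d y.1) = 0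
    rw [hd, map_add, E.d_d, zero_add, add_neg_cancel]
  leibniz := fun {p a} ha y => by
    refine Prod.ext (M.leibniz ha _) ?_
    change E.d (a • y.2) + g (a • y.1) = B.d a • y.2 + (-1 : ℚ) ^ p • a • (E.d y.2 + g y.1)
    rw [hs, E.leibniz ha, B.eps_of_mem ha, smul_add, smul_add, smul_assoc, add_assoc]

/-! ### The homotopy retraction of a morphism injective in cohomology. -/

section Retraction

variable {N : DGModule.{u, u} B} {m : ℤ} {ω : N →ₗ[ℚ] ℚ}

theorem IsCycleFunctional.bounded (hω : N.IsCycleFunctional m ω) (n : N) :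
    ∃ k : ℤ, ∀ q, k < q → ∀ x ∈ B.gr q, ω (x • n) = 0 := by
  have hn : n ∈ ⨆ p, N.gr p := by rw [N.internal.submodule_iSup_eq_top]; exact Submodule.mem_top
  refine Submodule.iSup_induction _
    (motive := fun n => ∃ k : ℤ, ∀ q, k < q → ∀ x ∈ B.gr q, ω (x • n) = 0) hn
    (fun p n hn => ?_) ⟨0, fun q _ x _ => ?_⟩ ?_
  -- For `n` of degree `p`, the product `x n` has degree `m` only when `x` has degree `m - p`.
  · exact ⟨m - p, fun q hq x hx => hω.map_of_mem_ne (q + p) (by omega) _ (N.smul_mem hx hn)⟩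
  · rw [smul_zero, map_zero]
  · rintro n n' ⟨k, hk⟩ ⟨l, hl⟩
    refine ⟨max k l, fun q hq x hx => ?_⟩
    rw [smul_add, map_add, hk q (lt_of_le_of_lt (le_max_left _ _) hq) x hx,
      hl q (lt_of_le_of_lt (le_max_right _ _) hq) x hx, add_zero]

open CDGA.TwistedDual (eval)

/-- The map `n ↦ (x ↦ ω(x n))` from `N` to the bounded dual of `B`. -/
def toDual (hω : N.IsCycleFunctional m ω) : N →ₗ[ℚ] B.twistedDual m where
  toFun n := CDGA.TwistedDual.of
    (ω ∘ₗ (LinearMap.toSpanSingleton B N n).restrictScalars ℚ) (hω.bounded n)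
  map_add' n n' := CDGA.TwistedDual.ext fun x => by
    change ω (x • (n + n')) = ω (x • n) + ω (x • n')
    rw [smul_add, map_add]
  map_smul' r n := CDGA.TwistedDual.ext fun x => by
    change ω (x • r • n) = r • ω (x • n)
    rw [smul_comm x r n, map_smul]

theorem eval_toDual (hω : N.IsCycleFunctional m ω) (n : N) (x : B) :
    eval (toDual hω n) x = ω (x • n) := rfl

/-- Together with `toDual_d` and `toDual_mem`, this says that `toDual` is a morphism of degree `1`
in the graded sense: it is linear up to the degree involution and anticommutes with the
differentials. These are the conditions that `twistedProd` requires, so a map into an unshifted dual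
has become one whose fibre can be formed directly. -/
theorem toDual_smul (hω : N.IsCycleFunctional m ω) (a : B) (n : N) :
    toDual hω (a • n) = B.eps a • toDual hω n :=
  CDGA.TwistedDual.ext fun x => by
    rw [eval_toDual]
    refine Eq.trans ?_ (CDGA.TwistedDual.eval_smul _ _ _).symm
    rw [eval_toDual, CDGA.eps_eps, mul_smul]

theorem toDual_d (hω : N.IsCycleFunctional m ω) (n : N) :
    toDual hω (N.d n) = -(B.twistedDual m).d (toDual hω n) :=
  CDGA.TwistedDual.ext fun x => by
    -- The anticommutation is the Leibniz rule together with the vanishing of `ω` on coboundaries;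
    -- applying it to `B.eps x` removes the sign in front of `N.d n`.
    have h := hω.map_d (B.eps x • n)
    rw [d_smul, map_add, CDGA.eps_eps] at h
    change ω (x • N.d n) = -ω (B.d (B.eps x) • n)
    linear_combination h

theorem toDual_mem (hω : N.IsCycleFunctional m ω) {p : ℤ} {n : N} (hn : n ∈ N.gr p) :
    toDual hω n ∈ (B.twistedDual m).gr (p + 1) := by
  intro q hq x hx
  exact hω.map_of_mem_ne (q + p) (by omega) _ (N.smul_mem hx hn)

/-- The map `(n, b) ↦ toDual (n - f b)`. -/
def pullbackMap (f : Hom B.self N) (hω : N.IsCycleFunctional m ω) :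
    N.prod B.self →ₗ[ℚ] B.twistedDual m :=
  toDual hω ∘ₗ (LinearMap.fst ℚ N B.self -
    f.toLinearMap.restrictScalars ℚ ∘ₗ LinearMap.snd ℚ N B.self)

/-- The homotopy pullback of `toDual : N → B^♯` and its composite with `f : B → N`. -/
def homotopyPullback (f : Hom B.self N) (hω : N.IsCycleFunctional m ω) : DGModule.{u, u} B :=
  twistedProd (N.prod B.self) (B.twistedDual m) (pullbackMap f hω)
    (fun hx => toDual_mem hω (Submodule.sub_mem _ hx.1 (f.map_gr hx.2)))
    (fun a x => by
      refine Eq.trans ?_ (toDual_smul hω a _)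
      refine congrArg (toDual hω) ?_
      change a • x.1 - f.toLinearMap (a • x.2) = a • (x.1 - f.toLinearMap x.2)
      rw [map_smul, smul_sub])
    (fun x => by
      refine Eq.trans ?_ (toDual_d hω _)
      refine congrArg (toDual hω) ?_
      change N.d x.1 - f.toLinearMap (B.self.d x.2) = N.d (x.1 - f.toLinearMap x.2)
      rw [f.map_d, map_sub])

/-- The map `b ↦ (x ↦ ω(x f(b)))` is injective in cohomology. -/
theorem exists_d_eq_of_toDual_eq {e : B →ₗ[ℚ] ℚ} (he : B.IsDualizing m e) (f : Hom B.self N)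
    (hω : N.IsCycleFunctional m ω) (hωe : ∀ z : B, B.d z = 0 → ω (f.toLinearMap z) = e z)
    {b : B} (hb : B.d b = 0) (φ : B.twistedDual m)
    (h : toDual hω (f.toLinearMap b) = (B.twistedDual m).d φ) : ∃ y, B.d y = b := by
  -- By nondegeneracy it is enough to pair `b` with cocycles `x`, and there `e(x b) = ω(x f(b))` is
  -- a value of `φ` at `d(εx) = -ε(dx) = 0`.
  refine he.exists_d_eq hb fun x hx => ?_
  have h1 : ω (x • f.toLinearMap b) = eval φ (B.d (B.eps x)) :=
    congrArg (fun ψ => eval ψ x) h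
  have h2 : f.toLinearMap (x • b : B) = x • f.toLinearMap b := map_smul f.toLinearMap x b
  rw [← hωe (x * b) (B.mul_mem_ker hx hb)]
  refine (congrArg ω h2).trans (h1.trans ?_)
  rw [CDGA.d_eps, hx, map_zero, neg_zero, map_zero]

/-- The map `b ↦ (x ↦ ω(x f(b)))` is surjective in cohomology. -/
theorem exists_toDual_add_d_eq {e : B →ₗ[ℚ] ℚ} (he : B.IsDualizing m e) (f : Hom B.self N)
    (hω : N.IsCycleFunctional m ω) (hωe : ∀ z : B, B.d z = 0 → ω (f.toLinearMap z) = e z)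
    (φ : B.twistedDual m) (hφ : (B.twistedDual m).d φ = 0) :
    ∃ b, B.d b = 0 ∧ ∃ η, toDual hω (f.toLinearMap b) + (B.twistedDual m).d η = φ := by
  have hφ' : ∀ x, eval φ (B.d x) = 0 := fun x => by
    have h : eval φ (B.d (B.eps (B.eps x))) = 0 := congrArg (fun ψ => eval ψ (B.eps x)) hφ
    rwa [CDGA.eps_eps] at h
  obtain ⟨b, hb, hφb⟩ := he.exists_eq (eval φ) hφ'
  refine ⟨b, hb, ?_⟩
  obtain ⟨k, hk⟩ := CDGA.TwistedDual.bounded (φ - toDual hω (f.toLinearMap b))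
  -- By the choice of `b`, the difference `φ - toDual (f b)` vanishes on every cocycle, so it
  -- factors through the differential as `χ ∘ d`.
  obtain ⟨χ, hχ⟩ := exists_comp_eq B.d (eval (φ - toDual hω (f.toLinearMap b))) (fun x hx => by
    have h : f.toLinearMap (x • b : B) = x • f.toLinearMap b := map_smul f.toLinearMap x b
    change eval φ x - ω (x • f.toLinearMap b) = 0
    rw [hφb x hx, ← hωe (x * b) (B.mul_mem_ker hx hb), sub_eq_zero]
    exact congrArg ω h)
  -- The functional `χ` need not be bounded, so it is cut off. The bound is `k + 1` because `d`
  -- raises degrees by one: for `y` in degree `p > k` the value `χ(dy)` is zero anyway, so the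
  -- truncation leaves `χ ∘ d` unchanged.
  let T : B →ₗ[ℚ] B := ∑ q ∈ Finset.Icc 0 (k + 1), proj B.internal q
  have hT0 : ∀ q, k + 1 < q → ∀ x ∈ B.gr q, T x = 0 := fun q hq x hx => by
    rw [LinearMap.sum_apply]
    refine Finset.sum_eq_zero fun p hp => ?_
    rw [Finset.mem_Icc] at hp
    exact proj_of_mem_ne _ (by omega) hx
  have hT : ∀ x, χ (T (B.d x)) = χ (B.d x) := by
    intro x
    refine homogeneous_induction B.internal (f := χ ∘ₗ T ∘ₗ B.d) (g := χ ∘ₗ B.d) ?_ x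
    intro p y hy
    change χ (T (B.d y)) = χ (B.d y)
    by_cases hy0 : y = 0
    · simp [hy0]
    have hp := nonneg_of_ne_zero hy hy0
    by_cases hpk : p ≤ k
    · rw [LinearMap.sum_apply, Finset.sum_eq_single (p + 1),
        proj_of_mem _ (B.d_mem hy)]
      · intro q _ hq
        exact proj_of_mem_ne _ hq.symm (B.d_mem hy)
      · intro h
        exact absurd (Finset.mem_Icc.2 ⟨by omega, by omega⟩) h
    · rw [hT0 (p + 1) (by omega) _ (B.d_mem hy), map_zero, hχ, hk p (by omega) y hy]
  -- The sign and the involution in the primitive cancel those coming from `φ ↦ φ d ε`, since `ε d ε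
  -- = -d`.
  refine ⟨CDGA.TwistedDual.of (-(χ ∘ₗ T ∘ₗ B.eps)) ⟨k + 1, fun q hq x hx => ?_⟩,
    CDGA.TwistedDual.ext fun x => ?_⟩
  · rw [LinearMap.neg_apply, LinearMap.comp_apply, LinearMap.comp_apply,
      hT0 q hq _ (B.eps_mem hx), map_zero, neg_zero]
  · have h : χ (B.d x) = eval φ x - ω (x • f.toLinearMap b) := hχ x
    change ω (x • f.toLinearMap b) + -χ (T (B.eps (B.d (B.eps x)))) = eval φ x
    rw [CDGA.d_eps, map_neg, CDGA.eps_eps, map_neg, map_neg, hT, h]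
    ring

/-- If `B` has a dualizing functional, a morphism `f : B → N` with `H(f)` injective admits a
homotopy retraction. -/
theorem Hom.hasHomotopyRetraction_of_injective {e : B →ₗ[ℚ] ℚ} (he : B.IsDualizing m e)
    (f : Hom B.self N) (hf : Function.Injective f.H) : f.HasHomotopyRetraction := by
  obtain ⟨ω, hω, hωe⟩ := exists_isCycleFunctional he f hf
  refine ⟨homotopyPullback f hω, 
    { toLinearMap := LinearMap.inl B (N × B.self) (B.twistedDual m) ∘ₗ
        (f.toLinearMap.prod LinearMap.id)
      map_gr := fun hx => ⟨⟨f.map_gr hx, hx⟩, Submodule.zero_mem _⟩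
      map_d := fun b => ?_ },
    { toLinearMap := LinearMap.fst B N B.self ∘ₗ LinearMap.fst B (N × B.self) (B.twistedDual m)
      map_gr := fun hx => hx.1.1
      map_d := fun _ => rfl },
    { toLinearMap := LinearMap.snd B N B.self ∘ₗ LinearMap.fst B (N × B.self) (B.twistedDual m)
      map_gr := fun hx => hx.1.2
      map_d := fun _ => rfl }, ⟨?_, ?_⟩, fun _ => rfl, fun _ => rfl⟩
  · refine Prod.ext (Prod.ext (f.map_d b) rfl) ?_
    change 0 = (B.twistedDual m).d 0 + toDual hω (f.toLinearMap b - f.toLinearMap b)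
    rw [sub_self, map_zero, map_zero, add_zero]
  · refine (Cohomology.map_injective_iff _ _).2 ?_
    rintro ⟨⟨n, b⟩, φ⟩ hz n' hn'
    change N.d n' = n at hn'
    have hb : B.d b = 0 := congrArg (fun y => y.1.2) hz
    have hφ : (B.twistedDual m).d φ + toDual hω (n - f.toLinearMap b) = 0 :=
      congrArg (fun y => y.2) hz
    rw [map_sub, ← hn', toDual_d] at hφ
    -- As `n = dn'`, the cocycle condition says that the image of `b` in the dual is the coboundary
    -- of `φ - toDual n'`. Injectivity of `H(B) → H(B^♯)` then makes `b` a coboundary `dy`.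
    obtain ⟨y, hy⟩ := exists_d_eq_of_toDual_eq he f hω hωe hb (φ - toDual hω n') (by
      rw [map_sub, ← sub_eq_zero, ← neg_eq_zero, ← hφ]; abel)
    have hfy : f.toLinearMap b = N.d (f.toLinearMap y) :=
      (congrArg f.toLinearMap hy.symm).trans (f.map_d y)
    -- The pair `(n', y)` bounds `(n, b)` but leaves a cocycle in the dual as obstruction. By
    -- surjectivity of `H(B) → H(B^♯)` its class comes from a cocycle `c`, and replacing `y` by `y -
    -- c` removes it.
    obtain ⟨c, hc, η, hη⟩ := exists_toDual_add_d_eq he f hω hωe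
      (φ - toDual hω n' + toDual hω (f.toLinearMap y)) (by
        rw [hfy, toDual_d] at hφ
        rw [map_add, map_sub, ← hφ]; abel)
    refine ⟨((n', y - c), η), Prod.ext (Prod.ext hn' ?_) ?_⟩
    · change B.d (y - c) = b
      rw [map_sub, hy, hc]
      exact sub_zero _
    · change (B.twistedDual m).d η + toDual hω (n' - f.toLinearMap (y - c)) = φ
      have h : f.toLinearMap (y - c) = f.toLinearMap y - f.toLinearMap c := map_sub f.toLinearMap y c
      rw [h, map_sub, map_sub, ← sub_eq_zero]
      rw [← sub_eq_zero] at hη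
      rw [← hη]; abel
  · refine Cohomology.map_surjective_of _ _ fun n hn => ?_
    -- The image of `n` in the dual is cohomologous to that of a cocycle of `B`, by surjectivity;
    -- the sign is chosen so that `-b` and the homotopy `η` complete `n` to a cocycle.
    obtain ⟨b, hb, η, hη⟩ := exists_toDual_add_d_eq he f hω hωe (-toDual hω n) (by
      rw [map_neg, ← toDual_d, hn, map_zero])
    refine ⟨((n, -b), η), Prod.ext (Prod.ext hn ?_) ?_, rfl⟩
    · change B.d (-b) = 0
      rw [map_neg, hb, neg_zero]
    · change (B.twistedDual m).d η + toDual hω (n - f.toLinearMap (-b)) = 0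
      have h : f.toLinearMap (-b) = -f.toLinearMap b := map_neg f.toLinearMap b
      rw [h, sub_neg_eq_add, map_add, ← add_neg_cancel (toDual hω n), ← hη]; abel

end Retraction

end DGModule

/-! ### The cohomology of a tensor product -/

namespace CDGA

variable (A : CDGA.{u})

/-- There is a map `σ` of odd degree with `d σ d = d`. -/
theorem exists_splitting : ∃ σ : A →ₗ[ℚ] A, (∀ a, A.d (σ (A.d a)) = A.d a) ∧
    ∀ a, σ (A.eps a) = -A.eps (σ a) := by
  obtain ⟨g, hg⟩ := A.d.rangeRestrict.exists_rightInverse_of_surjective A.d.range_rangeRestrict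
  obtain ⟨τ, hτ⟩ := g.exists_extend
  have h : ∀ a, A.d (τ (A.d a)) = A.d a := fun a => by
    have h1 : τ (A.d a) = g (A.d.rangeRestrict a) := LinearMap.congr_fun hτ (A.d.rangeRestrict a)
    rw [h1]
    exact congrArg Subtype.val (LinearMap.congr_fun hg (A.d.rangeRestrict a))
  -- This is the odd part of `τ` under conjugation by `ε`. Since `ε` anticommutes with `d`, the
  -- conjugate satisfies `d(ετε)d = -d`, so half the difference still splits `d`.
  refine ⟨(2 : ℚ)⁻¹ • (τ - A.eps ∘ₗ τ ∘ₗ A.eps), fun a => ?_, fun a => ?_⟩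
  · have h2 : A.d (A.eps (τ (A.eps (A.d a)))) = -A.d a := by
      rw [← neg_neg (A.eps (A.d a)), ← d_eps, map_neg, map_neg, map_neg, d_eps, h, d_eps, map_neg,
        eps_eps, neg_neg]
    simp only [LinearMap.smul_apply, LinearMap.sub_apply, LinearMap.comp_apply, map_smul, map_sub,
      h, h2]
    module
  · simp only [LinearMap.smul_apply, LinearMap.sub_apply, LinearMap.comp_apply, map_smul, map_sub,
      eps_eps]
    module

/-- A linear map on `A ⊗ A` that vanishes on coboundaries and on the tensor products of cocycles
vanishes on all cocycles. -/
theorem tensor_eq_zero_of_cocycles {M : Type v} [AddCommGroup M] [Module ℚ M]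
    (χ : TensorCarrier A A →ₗ[ℚ] M) (hd : ∀ x, χ (tensorD A A x) = 0)
    (h : ∀ z w, A.d z = 0 → A.d w = 0 → χ (tmk A A z w) = 0)
    {x : TensorCarrier A A} (hx : tensorD A A x = 0) : χ x = 0 := by
  obtain ⟨σ, hσ, hσε⟩ := A.exists_splitting
  -- `π` is homotopic to the identity, takes values in cocycles and kills coboundaries. It replaces
  -- a choice of representatives of cohomology.
  let π : A →ₗ[ℚ] A := LinearMap.id - A.d ∘ₗ σ - σ ∘ₗ A.d
  have hπ : ∀ a, π a = a - A.d (σ a) - σ (A.d a) := fun a => rfl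
  have hdπ : ∀ a, A.d (π a) = 0 := fun a => by rw [hπ, map_sub, map_sub, A.d_d, hσ]; simp
  have hπd : ∀ a, π (A.d a) = 0 := fun a => by rw [hπ, hσ, A.d_d, map_zero]; simp
  have hπε : ∀ a, π (A.eps a) = A.eps (π a) := fun a => by
    simp [hπ, hσε, d_eps]
  -- `K = σ ⊗ 1 + επ ⊗ σ` is the usual homotopy on a tensor product: it deforms the first factor,
  -- then the second, and so joins the identity to `π ⊗ π`. Every cocycle is therefore cohomologous
  -- to a sum of tensors of cocycles, which is the part of the Künneth theorem that is needed.
  let K : TensorCarrier A A →ₗ[ℚ] TensorCarrier A A := tensorLift A A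
    ((tmk A A).compl₁₂ σ LinearMap.id + (tmk A A).compl₁₂ (A.eps ∘ₗ π) σ)
  have hK : ∀ a b, K (tmk A A a b) = tmk A A (σ a) b + tmk A A (A.eps (π a)) (σ b) :=
    fun a b => by
      rw [tensorLift_tmk]; simp
  have key : ∀ x, x = tensorLift A A ((tmk A A).compl₁₂ π π) x + tensorD A A (K x) +
      K (tensorD A A x) := by
    refine tensor_induction A A (f := LinearMap.id) (g := tensorLift A A ((tmk A A).compl₁₂ π π) +
      tensorD A A ∘ₗ K + K ∘ₗ tensorD A A) ?_
    intro p q a _ b _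
    simp only [LinearMap.add_apply, LinearMap.comp_apply, LinearMap.id_apply, tensorLift_tmk,
      LinearMap.compl₁₂_apply, hK, tensorD_tmk, map_add, hπd, hπε, hσε, eps_eps, d_eps, hdπ]
    have h1 : tmk A A a b = tmk A A (π a) b + tmk A A (A.d (σ a)) b + tmk A A (σ (A.d a)) b := by
      rw [← LinearMap.add_apply, ← LinearMap.add_apply, ← map_add, ← map_add, hπ]
      congr 2; abel
    have h2 : tmk A A (π a) b = tmk A A (π a) (π b) + tmk A A (π a) (A.d (σ b)) +
        tmk A A (π a) (σ (A.d b)) := by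
      rw [← map_add, ← map_add, hπ b]
      congr 1; abel
    rw [h1, h2]
    simp
    abel
  rw [key x, hx, map_zero, add_zero, map_add, hd, add_zero]
  refine tensor_induction A A (f := χ ∘ₗ tensorLift A A ((tmk A A).compl₁₂ π π)) (g := 0) ?_ x
  intro p q a _ b _
  rw [LinearMap.comp_apply, tensorLift_tmk]
  exact h _ _ (hdπ a) (hdπ b)

/-! ### The tensor square of a dualizing functional. -/

variable {A}

/-- The functional `a ⊗ b ↦ e(a) e(b)`. -/
def tensorFunctional (e : A →ₗ[ℚ] ℚ) : TensorCarrier A A →ₗ[ℚ] ℚ :=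
  tensorLift A A ((LinearMap.mul ℚ ℚ).compl₁₂ e e)

theorem tensorFunctional_tmk (e : A →ₗ[ℚ] ℚ) (a b : A) :
    tensorFunctional e (tmk A A a b) = e a * e b := by
  rw [tensorFunctional, tensorLift_tmk]; rfl

theorem tensorD_tmk_eq_zero {z w : A} (hz : A.d z = 0) (hw : A.d w = 0) :
    tensorD A A (tmk A A z w) = 0 := by
  rw [tensorD_tmk, hz, hw, map_zero, map_zero, LinearMap.zero_apply, add_zero]

/-- A functional on `A ⊗ A` that vanishes on coboundaries, as a functional on `H(A) ⊗ H(A)`. -/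
theorem exists_tensorH (ψ : TensorCarrier A A →ₗ[ℚ] ℚ) (hψ : ∀ x, ψ (tensorD A A x) = 0) :
    ∃ Ψ : A.H ⊗[ℚ] A.H →ₗ[ℚ] ℚ, ∀ z w : LinearMap.ker A.d,
      Ψ (Cohomology.cls A.d z ⊗ₜ Cohomology.cls A.d w) = ψ (tmk A A z w) := by
  -- Cocycle representatives are chosen linearly. They differ from given ones by coboundaries, and a
  -- coboundary tensored with a cocycle, on either side, is a coboundary up to sign, so `ψ` does not
  -- see the choice.
  obtain ⟨s, hs⟩ := (Cohomology.cls A.d).exists_rightInverse_of_surjective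
    (LinearMap.range_eq_top.2 (Cohomology.cls_surjective A.d))
  have hs' : ∀ z, ∃ x, (s (Cohomology.cls A.d z) : A) = z + A.d x := fun z => by
    have h : Cohomology.cls A.d (s (Cohomology.cls A.d z) - z) = 0 := by
      rw [map_sub, sub_eq_zero]
      exact LinearMap.congr_fun hs _
    obtain ⟨x, hx⟩ := (Cohomology.cls_eq_zero _).1 h
    exact ⟨x, by rw [hx, AddSubgroupClass.coe_sub]; abel⟩
  refine ⟨TensorProduct.lift (((tmk A A).compr₂ ψ).compl₁₂
    ((LinearMap.ker A.d).subtype ∘ₗ s) ((LinearMap.ker A.d).subtype ∘ₗ s)), fun z w => ?_⟩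
  rw [TensorProduct.lift.tmul]
  change ψ (tmk A A (s (Cohomology.cls A.d z)) (s (Cohomology.cls A.d w))) = _
  obtain ⟨x, hx⟩ := hs' z
  obtain ⟨y, hy⟩ := hs' w
  have hz : A.d z = 0 := z.2
  have hw : A.d w = 0 := w.2
  have h1 := hψ (tmk A A x (s (Cohomology.cls A.d w)))
  have h2 := hψ (tmk A A (A.eps z) y)
  rw [tensorD_tmk, show A.d (s (Cohomology.cls A.d w)) = 0 from (s _).2, map_zero, add_zero] at h1
  rw [tensorD_tmk, d_eps, hz, eps_eps] at h2
  simp only [map_zero, neg_zero, LinearMap.zero_apply, zero_add] at h2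
  rw [hx, map_add, LinearMap.add_apply, map_add, h1, add_zero, hy, map_add, map_add, h2, add_zero]

variable (A) in
/-- The involution `x ↦ (-1)^(p|x|) x`. -/
def sgn (p : ℤ) : A →ₗ[ℚ] A := if Even p then LinearMap.id else A.eps

theorem sgn_sgn (p : ℤ) (x : A) : A.sgn p (A.sgn p x) = x := by
  unfold sgn
  split_ifs
  · rfl
  · exact A.eps_eps x

theorem sgn_of_mem (p : ℤ) {q : ℤ} {x : A} (hx : x ∈ A.gr q) :
    A.sgn p x = ((-1 : ℚ) ^ (q * p)) • x := by
  unfold sgn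
  split_ifs with h
  · rw [(h.mul_left q).neg_one_zpow, one_smul, LinearMap.id_apply]
  · rw [mul_comm, zpow_mul, (Int.not_even_iff_odd.1 h).neg_one_zpow, A.eps_of_mem hx]

variable (A) in
theorem exists_sgn_d (p : ℤ) (x : A) : ∃ y, A.sgn p (A.d x) = A.d y := by
  unfold sgn
  split_ifs
  · exact ⟨x, rfl⟩
  · exact ⟨-A.eps x, by rw [map_neg, d_eps, neg_neg]⟩

variable (A) in
theorem d_sgn (p : ℤ) {x : A} (hx : A.d x = 0) : A.d (A.sgn p x) = 0 := by
  unfold sgn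
  split_ifs
  · exact hx
  · rw [d_eps, hx, map_zero, neg_zero]

/-- The Koszul sign from moving `a` past `w` depends, for fixed degree `p` of `a`, only on the
parities in `w`. Absorbing it into `sgn p` allows `w` to be inhomogeneous. -/
theorem tmk_mul_tmk_of_mem (z w : A) {p : ℤ} {a : A} (ha : a ∈ A.gr p) (b : A) :
    tmk A A z w * tmk A A a b = tmk A A (z * a) (A.sgn p w * b) := by
  refine homogeneous_induction A.internal
    (f := (LinearMap.mul ℚ (TensorCarrier A A)).flip (tmk A A a b) ∘ₗ tmk A A z)
    (g := tmk A A (z * a) ∘ₗ (LinearMap.mul ℚ A).flip b ∘ₗ A.sgn p) ?_ w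
  intro q x hx
  simp [tmk_mul_tmk A A z hx ha b, sgn_of_mem p hx]

namespace IsDualizing

variable {n : ℤ} {e : A →ₗ[ℚ] ℚ}

/-- A functional on `H(A)` is represented by a cocycle, up to the sign `(-1)^(p|z|)`. -/
theorem exists_eq_cls_sgn (he : A.IsDualizing n e) (p : ℤ) (ψ : A.H →ₗ[ℚ] ℚ) :
    ∃ c, A.d c = 0 ∧
      ∀ z : LinearMap.ker A.d, ψ (Cohomology.cls A.d z) = e (A.sgn p z * c) := by
  obtain ⟨φ, hφ⟩ := (ψ ∘ₗ Cohomology.cls A.d).exists_extend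
  have hφ' : ∀ z : LinearMap.ker A.d, φ z = ψ (Cohomology.cls A.d z) :=
    fun z => LinearMap.congr_fun hφ z
  have hφd : ∀ x, φ (A.d x) = 0 := fun x => by
    rw [hφ' ⟨A.d x, A.d_d x⟩, (Cohomology.cls_eq_zero _).2 ⟨x, rfl⟩, map_zero]
  -- Duality is applied to the functional already twisted by the sign, which is legitimate because
  -- `sgn p` preserves coboundaries; as `sgn p` is an involution, the twist is undone at the end.
  obtain ⟨c, hc, h⟩ := he.exists_eq (φ ∘ₗ A.sgn p) fun x => by
    obtain ⟨y, hy⟩ := A.exists_sgn_d p x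
    rw [LinearMap.comp_apply, hy, hφd]
  refine ⟨c, hc, fun z => ?_⟩
  have hz : A.d (A.sgn p z) = 0 := A.d_sgn p z.2
  rw [← h _ hz, LinearMap.comp_apply, sgn_sgn, hφ']

/-- Products of functionals on `H(A)` are represented by cocycles of `A ⊗ A`. -/
theorem exists_tensor_eq_tmul (he : A.IsDualizing n e) (ψ₁ ψ₂ : A.H →ₗ[ℚ] ℚ) :
    ∃ c, tensorD A A c = 0 ∧ ∀ z w : LinearMap.ker A.d,
      ψ₁ (Cohomology.cls A.d z) * ψ₂ (Cohomology.cls A.d w) =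
        tensorFunctional e (tmk A A z w * c) := by
  obtain ⟨a, ha, hψ₁⟩ := he.exists_eq_cls_sgn 0 ψ₁
  -- The second representative is chosen separately for each degree `p` of the component of `a` it
  -- is paired with, so that the Koszul sign `(-1)^(p|w|)` is built in and every term yields the
  -- same factor `ψ₂[w]`.
  choose b hb hψ₂ using fun p : ℤ => he.exists_eq_cls_sgn p ψ₂
  obtain ⟨s, hs⟩ := exists_sum_proj A.internal a
  refine ⟨∑ p ∈ s, tmk A A (proj A.internal p a) (b p), ?_, fun z w => ?_⟩
  · rw [map_sum]
    exact Finset.sum_eq_zero fun p _ => tensorD_tmk_eq_zero (d_proj ha p) (hb p)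
  · have hsum : e (A.sgn 0 z * a) = ∑ p ∈ s, e (z * proj A.internal p a) := by
      rw [← map_sum, ← Finset.mul_sum, hs, sgn, if_pos (by decide), LinearMap.id_apply]
    rw [hψ₁, hsum, Finset.sum_mul, Finset.mul_sum, map_sum]
    refine Finset.sum_congr rfl fun p _ => ?_
    rw [hψ₂ p, tmk_mul_tmk_of_mem _ _ (proj_mem A.internal p a), tensorFunctional_tmk]

/-- The tensor square of a dualizing functional is dualizing. -/
theorem tensor (he : A.IsDualizing n e) (hfin : FiniteDimensional ℚ A.H) :
    (A.tensor A).IsDualizing (n + n) (tensorFunctional e) := by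
  have hd : ∀ x, tensorFunctional e (tensorD A A x) = 0 := by
    refine tensor_induction A A (f := tensorFunctional e ∘ₗ tensorD A A) (g := 0) ?_
    intro p q a _ b _
    simp [tensorD_tmk, tensorFunctional_tmk, he.map_d]
  have hgr : ∀ q, q ≠ n + n → tensorGr A A q ≤ LinearMap.ker (tensorFunctional e) := by
    intro q hq
    refine Submodule.span_le.2 ?_
    rintro _ ⟨p, p', hpp, a, ha, b, hb, rfl⟩
    change tensorFunctional e (tmk A A a b) = 0
    rw [tensorFunctional_tmk]
    by_cases h : p = n
    · rw [he.map_of_mem_ne p' (by omega) b hb, mul_zero]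
    · rw [he.map_of_mem_ne p h a ha, zero_mul]
  have hex : ∀ ψ : TensorCarrier A A →ₗ[ℚ] ℚ, (∀ x, ψ (tensorD A A x) = 0) →
      ∃ c, tensorD A A c = 0 ∧
        ∀ x, tensorD A A x = 0 → ψ x = tensorFunctional e (x * c) := by
    intro ψ hψ
    obtain ⟨Ψ, hΨ⟩ := exists_tensorH ψ hψ
    -- Finite dimensionality enters here: every functional on `H(A) ⊗ H(A)` is a finite sum of
    -- products of functionals, and each product is represented by a cocycle.
    obtain ⟨t, rfl⟩ := (TensorProduct.dualDistribEquiv ℚ A.H A.H).surjective Ψ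
    have key : ∃ c, tensorD A A c = 0 ∧ ∀ z w : LinearMap.ker A.d,
        TensorProduct.dualDistrib ℚ A.H A.H t (Cohomology.cls A.d z ⊗ₜ Cohomology.cls A.d w) =
          tensorFunctional e (tmk A A z w * c) := by
      clear hΨ
      induction t with
      | zero => exact ⟨0, map_zero _, fun z w => by simp⟩
      | tmul ψ₁ ψ₂ =>
        obtain ⟨c, hc, h⟩ := he.exists_tensor_eq_tmul ψ₁ ψ₂
        exact ⟨c, hc, fun z w => by rw [← h, TensorProduct.dualDistrib_apply]⟩
      | add t t' h h' =>
        obtain ⟨c, hc, h⟩ := h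
        obtain ⟨c', hc', h'⟩ := h'
        exact ⟨c + c', by rw [map_add, hc, hc', add_zero], fun z w => by
          rw [map_add, LinearMap.add_apply, h, h', mul_add, map_add]⟩
    obtain ⟨c, hc, h⟩ := key
    refine ⟨c, hc, fun x hx => ?_⟩
    rw [← sub_eq_zero]
    -- So far the equality is known on tensors of cocycles only. Both sides kill coboundaries, the
    -- right one because `c` is a cocycle, so the Künneth argument extends it to all cocycles.
    refine A.tensor_eq_zero_of_cocycles
      (ψ - tensorFunctional e ∘ₗ (LinearMap.mul ℚ (TensorCarrier A A)).flip c) ?_ ?_ hx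
    · intro y
      have h1 : tensorD A A (y * c) = tensorD A A y * c := by
        refine ((A.tensor A).d_mul y c).trans ?_
        rw [show (A.tensor A).d c = 0 from hc, mul_zero, add_zero]
        rfl
      have h2 : tensorFunctional e (tensorD A A y * c) = 0 := by rw [← h1]; exact hd _
      exact (congrArg₂ (· - ·) (hψ y) h2).trans (sub_zero _)
    · intro z w hz hw
      exact sub_eq_zero.2 ((hΨ ⟨z, hz⟩ ⟨w, hw⟩).symm.trans (h ⟨z, hz⟩ ⟨w, hw⟩))
  exact ⟨hd, fun q hq x hx => hgr q hq hx, hex⟩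

end IsDualizing

/-! ### Poincaré duality -/

/-- Poincaré duality passes from the cohomology of `C` to a dualizing functional on a
quasi-isomorphic algebra. -/
theorem Hom.IsQuasiIso.exists_isDualizing {C : CDGA.{v}} {f : Hom A C} (hf : f.IsQuasiIso)
    (hC : C.cohomology.IsPoincareDualityAlgebra) :
    FiniteDimensional ℚ A.H ∧ ∃ (n : ℤ) (e : A →ₗ[ℚ] ℚ), A.IsDualizing n e := by
  obtain ⟨hfin, -, -, n, -, -, -, -, ω, -, hω, hbij⟩ := hC
  change FiniteDimensional ℚ C.H at hfin
  change C.H →ₗ[ℚ] ℚ at ω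
  have hsurj : ∀ ψ : C.H →ₗ[ℚ] ℚ, ∃ c, ∀ x, ψ x = ω (x * c) := by
    -- The definition of duality puts the representing class on the left, whereas here it is wanted
    -- on the right. If `ω(a x) = 0` for all `a`, then every functional kills `x`, so `Φ` is
    -- injective, and equality of dimensions makes it surjective.
    let Φ : C.H →ₗ[ℚ] C.H →ₗ[ℚ] ℚ := (C.mulH.compr₂ ω).flip
    have hinj : Function.Injective Φ := by
      rw [injective_iff_map_eq_zero]
      intro x hx
      rw [← Module.forall_dual_apply_eq_zero_iff ℚ x]
      intro ψ
      obtain ⟨a, rfl⟩ := hbij.2 ψ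
      exact LinearMap.congr_fun hx a
    intro ψ
    obtain ⟨c, rfl⟩ := (LinearMap.injective_iff_surjective_of_finrank_eq_finrank
      (Subspace.dual_finrank_eq (K := ℚ) (V := C.H)).symm).1 hinj ψ
    exact ⟨c, fun x => rfl⟩
  let g := LinearEquiv.ofBijective _ hf
  refine ⟨Module.Finite.equiv g.symm, n, ?_⟩
  -- The functional on cohomology is pulled back to cocycles and extended arbitrarily to `A`. The
  -- extension is then composed with the projection to degree `n`; on cocycles this changes nothing,
  -- because `ω` vanishes outside degree `n` and `g` preserves degrees.
  obtain ⟨φ, hφ⟩ := (ω ∘ₗ g.toLinearMap ∘ₗ Cohomology.cls A.d).exists_extend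
  have hφ' : ∀ z : LinearMap.ker A.d, φ z = ω (g (Cohomology.cls A.d z)) :=
    fun z => LinearMap.congr_fun hφ z
  have hgr : ∀ p (z : LinearMap.ker A.d), (z : A) ∈ A.gr p → g (Cohomology.cls A.d z) ∈ C.grH p := by
    intro p z hz
    refine ⟨⟨f.toAlgHom z, ?_⟩, f.map_gr hz, rfl⟩
    rw [LinearMap.mem_ker, ← f.map_d, show A.d z = 0 from z.2, map_zero]
  have hgmul : ∀ z w : LinearMap.ker A.d, g (Cohomology.cls A.d (A.mulZ z w)) =
      g (Cohomology.cls A.d z) * g (Cohomology.cls A.d w) := by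
    intro z w
    exact congrArg (Cohomology.cls C.d) (Subtype.ext (map_mul f.toAlgHom (z : A) w))
  have he : ∀ z : LinearMap.ker A.d, φ (proj A.internal n z) = ω (g (Cohomology.cls A.d z)) := by
    intro z
    obtain ⟨s, hs⟩ := exists_sum_proj A.internal (z : A)
    rw [← hφ', ← hs, map_sum, map_sum, map_sum]
    refine Finset.sum_congr rfl fun p _ => ?_
    have hp := proj_mem A.internal p (z : A)
    by_cases h : p = n
    · rw [← h, proj_of_mem _ hp]
    · rw [proj_of_mem_ne _ h hp, map_zero, hφ' ⟨_, d_proj z.2 p⟩]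
      exact (hω p h _ (hgr p _ hp)).symm
  refine ⟨φ ∘ₗ proj A.internal n, ?_, ?_, ?_⟩
  · intro x
    refine (he ⟨A.d x, A.d_d x⟩).trans ?_
    rw [(Cohomology.cls_eq_zero _).2 ⟨x, rfl⟩, map_zero, map_zero]
  · intro q hq x hx
    rw [LinearMap.comp_apply, proj_of_mem_ne _ hq hx, map_zero]
  · intro ψ hψ
    let Ψ : A.H →ₗ[ℚ] ℚ := Submodule.liftQ _ (ψ ∘ₗ (LinearMap.ker A.d).subtype) (by
      rintro z ⟨x, hx⟩
      exact (congrArg ψ hx).symm.trans (hψ x))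
    obtain ⟨c, hc⟩ := hsurj (Ψ ∘ₗ g.symm.toLinearMap)
    obtain ⟨c, rfl⟩ := g.surjective c
    obtain ⟨c, rfl⟩ := Cohomology.cls_surjective _ c
    refine ⟨c, c.2, fun z hz => ?_⟩
    refine Eq.trans ?_ (he (A.mulZ ⟨z, hz⟩ c)).symm
    rw [hgmul, ← hc]
    refine Eq.trans ?_ (congrArg Ψ (g.symm_apply_apply _).symm)
    rfl

end CDGA

end RHT

end

/-- Let `X` be a simply connected space of the homotopy type of a CW complex of finite type, with
Sullivan model `(ΛV, d)`. If `H^*(X)` is a Poincaré duality algebra, then `htc(X) = mtc(X)`. -/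
theorem mainTheorem4 (X : Type u) [TopologicalSpace X] [SimplyConnectedSpace X]
    (hX : RHT.HasFiniteTypeCWHomotopyType X) (S : RHT.SullivanModel.{u, v} X)
    (hPD : (RHT.rationalCohomology X).IsPoincareDualityAlgebra) :
    S.htc = S.mtc := by
  obtain ⟨hfin, n, e, he⟩ := S.isQuasiIso.exists_isDualizing hPD
  -- The two conditions agree for each `k` separately, so the infima run over the same set.
  have h : ∀ k, Function.Injective (RHT.projTC S.algebra k).H ↔
      (RHT.projTC S.algebra k).HasHomotopyRetraction := fun k =>
    ⟨fun h => RHT.DGModule.Hom.hasHomotopyRetraction_of_injective (he.tensor hfin) _ h,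
      fun h => h.injective⟩
  simp only [RHT.SullivanModel.htc, RHT.SullivanModel.mtc, h]
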